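/- Let $B=(B(t))_{t\ge 0}$ be a fractional Brownian motion with Hurst parameter $H=1/6$, that is, a centered Gaussian process with $$E[B(s)B(t)]=\tfrac12\bigl(t^{1/3}+s^{1/3}-|t-s|^{1/3}\bigr),\qquad s,t\ge 0.$$ For an integer $n\ge 1$ and integers $j\ge 0$ put $t_j=j/n$ and $\beta_j=\tfrac12\bigl(B(t_{j-1})+B(t_j)\bigr)$, where for $j=0$ we set $B(t_{-1}):=B(0)$, so that $\beta_0=B(0)$; for $j\ge1$ put $\Delta B_j=B(t_j)-B(t_{j-1})$. Suppose $g\in C^3(\mathbb R)$ has compact support, and let $T>0$. Then there is a constant $C\in(0,\infty)$, depending only on $g$ and $T$, such that for every $n\ge1$ and all integers $c,d$ with $0\le t_c<t_d\le T$, the random variable $\sum_{j=c+1}^{d}\bigl(g(\beta_j)-g(\beta_c)\bigr)(\Delta B_j)^3$ is square integrable and $$E\,\Bigl|\sum_{j=c+1}^{d}\bigl(g(\beta_j)-g(\beta_c)\bigr)(\Delta B_j)^3\Bigr|^2\le C\,|t_d-t_c|^{4/3}.$$ -/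

import Mathlib

open MeasureTheory ProbabilityTheory
open scoped NNReal

/-- `B = (B(t))_{t ≥ 0}` is a fractional Brownian motion with Hurst parameter `H = 1/6` under `P`:
a centered Gaussian process with covariance
`E[B(s) B(t)] = (t^{1/3} + s^{1/3} - |t - s|^{1/3}) / 2`. -/
structure IsFractionalBrownianSixth {Ω : Type*} [MeasurableSpace Ω]
    (B : ℝ≥0 → Ω → ℝ) (P : Measure Ω) : Prop where
  isGaussianProcess : IsGaussianProcess B P
  centered : ∀ t : ℝ≥0, ∫ ω, B t ω ∂P = 0
  covariance : ∀ s t : ℝ≥0, ∫ ω, B s ω * B t ω ∂P =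
    (1 / 2 : ℝ) * ((t : ℝ) ^ (1 / 3 : ℝ) + (s : ℝ) ^ (1 / 3 : ℝ)
      - |(t : ℝ) - (s : ℝ)| ^ (1 / 3 : ℝ))

/-- The uniform grid `t_j = t_{j,n} = j / n`. -/
noncomputable def gridTime (n j : ℕ) : ℝ≥0 := (j : ℝ≥0) / (n : ℝ≥0)

/-- The midpoint average `β_j = (B(t_{j-1}) + B(t_j)) / 2`. For `j = 0` the truncated subtraction
`0 - 1 = 0` gives `β_0 = B(0)`. This is the convention `B(t) = B(0)` for negative times
(where `B(0) = 0` almost surely). -/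
noncomputable def midAverage {Ω : Type*} (B : ℝ≥0 → Ω → ℝ) (n j : ℕ) (ω : Ω) : ℝ :=
  (B (gridTime n (j - 1)) ω + B (gridTime n j) ω) / 2

/-- The increment `ΔB_j = B(t_j) - B(t_{j-1})`, used for `j ≥ 1` only. -/
noncomputable def gridIncrement {Ω : Type*} (B : ℝ≥0 → Ω → ℝ) (n j : ℕ) (ω : Ω) : ℝ :=
  B (gridTime n j) ω - B (gridTime n (j - 1)) ω

/-! Write `v = n^(-1/3)` for the variance of an increment and `G_j = g(β_j) - g(β_c)`. Split `x ^ 3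
= (x ^ 3 - 3 v x) + 3 v x`, a third Hermite polynomial plus a linear term, expand the square of each
sum, and bound the expectation for every pair `(i, j)` by Gaussian integration by parts.

Integrating by parts against `ΔB_i` differentiates in the direction `a`, the covariances with `ΔB_i`
divided by `v`. For the Hermite part three integrations give `v ^ 3` times a third derivative of
`G_i G_j H₃(ΔB_j)`, which is why `C^3` suffices (`integral_hermite_three_mul_eq`,
`abs_integral_hermite_pair_le`). For the linear part one integration against each of `ΔB_i` and
`ΔB_j` is enough (`abs_integral_linear_pair_le`). What is left has mean of order `e = |t_d -
t_c|^(1/3)`, because `g` is Lipschitz and `v ≤ e`.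

The coefficients of `a` are differences of `|x|^(1/3)`, so they decay like `(1 + |x|)^(-2/3)` in `x
= i - c` and `x = j - i`. The value at `β_i` itself would be of order one, but averaging the two
endpoints cancels its local part (`abs_midIncrementCoeff_self_le`). Every pair is then at most a
constant times `v ^ 3 * e * pairWeight c i j`, a sum of squared decays. As `∑ (1 + |z|)^(-4/3)`
converges, the weights add up to `O(d - c)`; with `v ^ 3 = 1 / n` the total is of order `e * (t_d -
t_c) = |t_d - t_c|^(4/3)`. -/

/-! ### Polynomial growth and Gaussian integrability. -/

/-- Continuous real functions of at most polynomial growth on a normed space. -/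
structure HasPolyGrowth {E : Type*} [NormedAddCommGroup E] (f : E → ℝ) : Prop where
  continuous : Continuous f
  bound : ∃ (K : ℝ) (N : ℕ), ∀ x, |f x| ≤ K * (1 + ‖x‖) ^ N

namespace HasPolyGrowth

variable {E : Type*} [NormedAddCommGroup E] {f h : E → ℝ}

theorem bound_nonneg (hf : HasPolyGrowth f) :
    ∃ (K : ℝ) (N : ℕ), 0 ≤ K ∧ ∀ x, |f x| ≤ K * (1 + ‖x‖) ^ N := by
  obtain ⟨K, N, hK⟩ := hf.bound
  refine ⟨K, N, ?_, hK⟩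
  have := (abs_nonneg _).trans (hK 0)
  simpa using this

theorem const (c : ℝ) : HasPolyGrowth (fun _ : E => c) :=
  ⟨continuous_const, |c|, 0, fun x => by simp⟩

theorem mul (hf : HasPolyGrowth f) (hh : HasPolyGrowth h) :
    HasPolyGrowth (fun x => f x * h x) := by
  obtain ⟨K, N, hK0, hK⟩ := hf.bound_nonneg
  obtain ⟨L, M, hL0, hL⟩ := hh.bound_nonneg
  refine ⟨hf.continuous.mul hh.continuous, K * L, N + M, fun x => ?_⟩
  rw [abs_mul, pow_add]
  calc |f x| * |h x| ≤ (K * (1 + ‖x‖) ^ N) * (L * (1 + ‖x‖) ^ M) :=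
        mul_le_mul (hK x) (hL x) (abs_nonneg _) (by positivity)
    _ = _ := by ring

theorem add (hf : HasPolyGrowth f) (hh : HasPolyGrowth h) :
    HasPolyGrowth (fun x => f x + h x) := by
  obtain ⟨K, N, hK0, hK⟩ := hf.bound_nonneg
  obtain ⟨L, M, hL0, hL⟩ := hh.bound_nonneg
  refine ⟨hf.continuous.add hh.continuous, K + L, N + M, fun x => ?_⟩
  have h1 : 1 ≤ 1 + ‖x‖ := by linarith [norm_nonneg x]
  calc |f x + h x| ≤ |f x| + |h x| := abs_add_le _ _
    _ ≤ K * (1 + ‖x‖) ^ N + L * (1 + ‖x‖) ^ M := add_le_add (hK x) (hL x)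
    _ ≤ K * (1 + ‖x‖) ^ (N + M) + L * (1 + ‖x‖) ^ (N + M) := by
        gcongr <;> first | exact h1 | omega
    _ = _ := by ring

theorem sub (hf : HasPolyGrowth f) (hh : HasPolyGrowth h) :
    HasPolyGrowth (fun x => f x - h x) := by
  have := hf.add ((const (E := E) (-1)).mul hh)
  simpa [sub_eq_add_neg] using this

theorem pow (hf : HasPolyGrowth f) (k : ℕ) : HasPolyGrowth (fun x => f x ^ k) := by
  induction k with
  | zero => simpa using const (E := E) 1
  | succ k ih => simpa [pow_succ] using ih.mul hf

theorem abs (hf : HasPolyGrowth f) : HasPolyGrowth (fun x => |f x|) :=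
  ⟨hf.continuous.abs, by simpa using hf.bound⟩

theorem of_bounded (hf : Continuous f) {M : ℝ} (hM : ∀ x, |f x| ≤ M) : HasPolyGrowth f :=
  ⟨hf, M, 0, by simpa using hM⟩

theorem clm [NormedSpace ℝ E] (L : E →L[ℝ] ℝ) : HasPolyGrowth (fun x => L x) := by
  refine ⟨L.continuous, ‖L‖, 1, fun x => ?_⟩
  have := L.le_opNorm x
  rw [Real.norm_eq_abs] at this
  nlinarith [norm_nonneg L]

theorem id_real : HasPolyGrowth (fun x : ℝ => x) :=
  clm (ContinuousLinearMap.id ℝ ℝ)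

theorem coord {ι : Type*} [Fintype ι] (k : ι) : HasPolyGrowth (fun y : ι → ℝ => y k) :=
  clm (ContinuousLinearMap.proj (R := ℝ) (φ := fun _ : ι => ℝ) k)

theorem comp_coord {ι : Type*} [Fintype ι] {p : ℝ → ℝ} (hp : HasPolyGrowth p) (k : ι) :
    HasPolyGrowth (fun y : ι → ℝ => p (y k)) := by
  obtain ⟨K, N, hK0, hK⟩ := hp.bound_nonneg
  refine ⟨hp.continuous.comp (continuous_apply _), K, N, fun y => (hK _).trans ?_⟩
  gcongr
  exact norm_le_pi_norm y k

theorem comp_line [NormedSpace ℝ E] (hf : HasPolyGrowth f) (z a : E) :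
    HasPolyGrowth (fun x : ℝ => f (z + x • a)) := by
  obtain ⟨K, N, hK0, hK⟩ := hf.bound_nonneg
  refine ⟨hf.continuous.comp (by fun_prop), K * (1 + ‖z‖ + ‖a‖) ^ N, N, fun x => ?_⟩
  refine (hK _).trans ?_
  rw [mul_assoc, ← mul_pow]
  gcongr
  have h1 : ‖z + x • a‖ ≤ ‖z‖ + ‖x‖ * ‖a‖ := (norm_add_le _ _).trans (by rw [norm_smul])
  nlinarith [norm_nonneg z, norm_nonneg a, norm_nonneg x,
    mul_nonneg (norm_nonneg z) (norm_nonneg x)]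

/-- A function of polynomial growth of a Gaussian variable is integrable. -/
theorem integrable_comp [NormedSpace ℝ E] [MeasurableSpace E] [BorelSpace E] [CompleteSpace E]
    [SecondCountableTopology E] {Ω : Type*} [MeasurableSpace Ω] {P : Measure Ω} {Y : Ω → E}
    (hf : HasPolyGrowth f) (hY : HasGaussianLaw Y P) : Integrable (fun ω => f (Y ω)) P := by
  have := hY.isProbabilityMeasure
  obtain ⟨K, N, hK0, hK⟩ := hf.bound_nonneg
  have hm : MemLp (fun ω => 1 + ‖Y ω‖) N P :=
    (memLp_const (1 : ℝ)).add (hY.memLp (p := N) (by simp)).norm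
  have hi : Integrable (fun ω => K * ‖1 + ‖Y ω‖‖ ^ N) P := (hm.integrable_norm_pow').const_mul K
  refine hi.mono' (hf.continuous.comp_aestronglyMeasurable hY.aemeasurable.aestronglyMeasurable)
    (Filter.Eventually.of_forall fun ω => ?_)
  rw [Real.norm_eq_abs, Real.norm_of_nonneg (by positivity)]
  exact hK _

theorem integrable_gaussianReal {f : ℝ → ℝ} (hf : HasPolyGrowth f) (v : ℝ≥0) :
    Integrable f (gaussianReal 0 v) :=
  hf.integrable_comp (IsGaussian.hasGaussianLaw_id (μ := gaussianReal 0 v))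

end HasPolyGrowth

/-! ### Integration by parts for a one-dimensional Gaussian. -/

theorem hasDerivAt_gaussianPDFReal {v : ℝ≥0} (hv : v ≠ 0) (x : ℝ) :
    HasDerivAt (gaussianPDFReal 0 v) (-(x / v) * gaussianPDFReal 0 v x) x := by
  have hv' : (v : ℝ) ≠ 0 := by exact_mod_cast hv
  rw [gaussianPDFReal_def]
  have h1 : HasDerivAt (fun x : ℝ => -(x - 0) ^ 2 / (2 * v)) (-(x / v)) x := by
    have := (((hasDerivAt_id x).sub_const 0).pow 2).neg.div_const (2 * (v : ℝ))
    convert! this using 1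
    simp only [id]
    field_simp
    simp [mul_comm]
  have := (h1.exp).const_mul ((√(2 * Real.pi * v))⁻¹)
  convert! this using 1
  ring

/-- One-dimensional Gaussian integration by parts. -/
theorem integral_mul_gaussianReal {v : ℝ≥0} (hv : v ≠ 0) {f f' : ℝ → ℝ}
    (hf : HasPolyGrowth f) (hf' : HasPolyGrowth f') (hd : ∀ x, HasDerivAt f (f' x) x) :
    ∫ x, x * f x ∂(gaussianReal 0 v) = v * ∫ x, f' x ∂(gaussianReal 0 v) := by
  have hv' : (v : ℝ) ≠ 0 := by exact_mod_cast hv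
  have key : ∀ {h : ℝ → ℝ}, HasPolyGrowth h →
      Integrable (fun x => gaussianPDFReal 0 v x * h x) := by
    intro h hh
    have h1 := hh.integrable_gaussianReal v
    rw [gaussianReal_of_var_ne_zero _ hv, integrable_withDensity_iff_integrable_smul'
      (measurable_gaussianPDF _ _) (Filter.Eventually.of_forall fun _ => gaussianPDF_lt_top)] at h1
    simpa using h1
  rw [integral_gaussianReal_eq_integral_smul hv, integral_gaussianReal_eq_integral_smul hv]
  simp only [smul_eq_mul]
  have h1 := integral_mul_deriv_eq_deriv_mul_of_integrable (u := f) (u' := f')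
    (v := gaussianPDFReal 0 v) (v' := fun x => -(x / v) * gaussianPDFReal 0 v x)
    (fun x _ => hd x) (fun x _ => hasDerivAt_gaussianPDFReal hv x)
    (by
      have := (key (HasPolyGrowth.id_real.mul hf)).const_mul (-(v : ℝ)⁻¹)
      refine this.congr (Filter.Eventually.of_forall fun x => ?_)
      simp only [Pi.mul_apply]
      ring)
    (by simpa [mul_comm, Pi.mul_def] using key hf')
    (by simpa [mul_comm, Pi.mul_def] using key hf)
  -- The density `φ` satisfies `x φ(x) = -v φ'(x)`.
  have h2 : ∫ x, gaussianPDFReal 0 v x * (x * f x)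
      = -(v : ℝ) * ∫ x, f x * (-(x / v) * gaussianPDFReal 0 v x) := by
    rw [← integral_const_mul]
    refine integral_congr_ae (Filter.Eventually.of_forall fun x => ?_)
    simp only
    field_simp
  rw [h2, h1]
  simp only [mul_comm (gaussianPDFReal _ _ _)]
  ring

/-! ### Calculus of directional derivatives with polynomial growth. -/

/-- `Φ'` is the derivative of `Φ` in the direction `a`, and both have polynomial growth. -/
structure HasPolyDirDeriv {ι : Type*} [Fintype ι] (a : ι → ℝ) (Φ Φ' : (ι → ℝ) → ℝ) : Prop where
  left : HasPolyGrowth Φ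
  right : HasPolyGrowth Φ'
  deriv : ∀ y, HasDerivAt (fun s : ℝ => Φ (y + s • a)) (Φ' y) 0

namespace HasPolyDirDeriv

variable {ι : Type*} [Fintype ι] {a : ι → ℝ} {Φ Φ' Ψ Ψ' : (ι → ℝ) → ℝ}

theorem deriv_line (h : HasPolyDirDeriv a Φ Φ') (z : ι → ℝ) (x : ℝ) :
    HasDerivAt (fun s : ℝ => Φ (z + s • a)) (Φ' (z + x • a)) x := by
  have h1 := h.deriv (z + x • a)
  have h2 : HasDerivAt (fun s : ℝ => s - x) 1 x := (hasDerivAt_id x).sub_const x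
  have h3 := HasDerivAt.comp (h₂ := fun s : ℝ => Φ (z + x • a + s • a)) x (by simpa using h1) h2
  simp only [mul_one] at h3
  convert! h3 using 1
  ext s
  simp only [Function.comp]
  congr 1
  rw [sub_smul]; abel

theorem mul (h : HasPolyDirDeriv a Φ Φ') (k : HasPolyDirDeriv a Ψ Ψ') :
    HasPolyDirDeriv a (fun y => Φ y * Ψ y) (fun y => Φ' y * Ψ y + Φ y * Ψ' y) :=
  ⟨h.left.mul k.left, (h.right.mul k.left).add (h.left.mul k.right), fun y => by
    simpa [Pi.mul_def] using! (h.deriv y).mul (k.deriv y)⟩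

theorem add (h : HasPolyDirDeriv a Φ Φ') (k : HasPolyDirDeriv a Ψ Ψ') :
    HasPolyDirDeriv a (fun y => Φ y + Ψ y) (fun y => Φ' y + Ψ' y) :=
  ⟨h.left.add k.left, h.right.add k.right, fun y => (h.deriv y).add (k.deriv y)⟩

theorem sub (h : HasPolyDirDeriv a Φ Φ') (k : HasPolyDirDeriv a Ψ Ψ') :
    HasPolyDirDeriv a (fun y => Φ y - Ψ y) (fun y => Φ' y - Ψ' y) :=
  ⟨h.left.sub k.left, h.right.sub k.right, fun y => (h.deriv y).sub (k.deriv y)⟩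

theorem const (c : ℝ) : HasPolyDirDeriv a (fun _ => c) (fun _ => 0) :=
  ⟨.const c, .const 0, fun _ => hasDerivAt_const _ _⟩

theorem coord (k : ι) : HasPolyDirDeriv a (fun y => y k) (fun _ => a k) :=
  ⟨.coord k, .const _, fun y => by
    simpa using ((hasDerivAt_id (0 : ℝ)).mul_const (a k)).const_add (y k)⟩

theorem comp_coord {f f' : ℝ → ℝ} {M M' : ℝ} (hf : ∀ x, HasDerivAt f (f' x) x)
    (hf' : Continuous f') (hM : ∀ x, |f x| ≤ M) (hM' : ∀ x, |f' x| ≤ M') (k : ι) :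
    HasPolyDirDeriv a (fun y => f (y k)) (fun y => a k * f' (y k)) := by
  have hc : Continuous f := continuous_iff_continuousAt.2 fun x => (hf x).continuousAt
  refine ⟨.of_bounded (hc.comp (continuous_apply k)) fun _ => hM _,
    (HasPolyGrowth.const _).mul (.of_bounded (hf'.comp (continuous_apply k)) fun _ => hM' _),
    fun y => ?_⟩
  have h1 : HasDerivAt (fun s : ℝ => y k + s * a k) (a k) 0 := by
    simpa using ((hasDerivAt_id (0 : ℝ)).mul_const (a k)).const_add (y k)
  have := HasDerivAt.comp (h₂ := f) (0 : ℝ) (hf _) h1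
  simpa [Function.comp_def, mul_comm] using this

theorem congr (h : HasPolyDirDeriv a Φ Φ') (h1 : ∀ y, Ψ y = Φ y) (h2 : ∀ y, Ψ' y = Φ' y) :
    HasPolyDirDeriv a Ψ Ψ' := by
  rwa [funext h1, funext h2]

end HasPolyDirDeriv

/-! ### Stein's lemma for Gaussian vectors, possibly degenerate. -/

section Stein

variable {ι : Type*} [Fintype ι] {Ω : Type*} [MeasurableSpace Ω] {P : Measure Ω}
  {W : Ω → ι → ℝ} {k₀ : ι} {v : ℝ} {a : ι → ℝ}

/-- The regression residual is uncorrelated with the coordinate, and it is jointly Gaussian with it.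
No density of the vector is needed, so the covariance matrix may be singular. -/
theorem indepFun_residual (hW : HasGaussianLaw W P) (h0 : ∫ ω, W ω k₀ ∂P = 0)
    (hvar : ∫ ω, W ω k₀ * W ω k₀ ∂P = v) (hcov : ∀ k, ∫ ω, W ω k * W ω k₀ ∂P = v * a k) :
    IndepFun (fun ω => W ω k₀) (fun ω => W ω - W ω k₀ • a) P := by
  have := hW.isProbabilityMeasure
  -- The coordinate is packaged as a family over `Unit`, since the independence criterion used below
  -- compares two families.
  let L : (ι → ℝ) →L[ℝ] (Unit → ℝ) × (ι → ℝ) :=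
    (ContinuousLinearMap.pi fun _ => ContinuousLinearMap.proj k₀).prod
      (ContinuousLinearMap.id ℝ _ - (ContinuousLinearMap.proj k₀ : (ι → ℝ) →L[ℝ] ℝ).smulRight a)
  have hL : HasGaussianLaw (fun ω => ((fun _ : Unit => W ω k₀), fun k => W ω k - W ω k₀ * a k)) P := by
    have := hW.map L
    convert! this using 1
  have hG : ∀ k, MemLp (fun ω => W ω k) 2 P := fun k =>
    (hW.map_of_measurable (.proj k) (measurable_pi_apply k)).memLp_two
  have key := hL.indepFun_of_covariance_eval (X := fun _ ω => W ω k₀)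
    (Y := fun k ω => W ω k - W ω k₀ * a k) (fun _ k => by
      have hZ : MemLp (fun ω => W ω k - W ω k₀ * a k) 2 P := (hG k).sub ((hG k₀).mul_const _)
      rw [covariance_eq_sub (hG k₀) hZ, h0, zero_mul, sub_zero]
      have : ∫ ω, ((fun ω => W ω k₀) * fun ω => W ω k - W ω k₀ * a k) ω ∂P
          = ∫ ω, (W ω k * W ω k₀ - a k * (W ω k₀ * W ω k₀)) ∂P := by
        congr 1; ext ω; simp only [Pi.mul_apply]; ring
      have i1 : Integrable (fun ω => W ω k * W ω k₀) P := (hG k).integrable_mul (hG k₀)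
      have i2 : Integrable (fun ω => W ω k₀ * W ω k₀) P := (hG k₀).integrable_mul (hG k₀)
      rw [this, integral_sub i1 (i2.const_mul _), integral_const_mul, hvar, hcov]
      ring)
  exact key.comp (φ := fun f : Unit → ℝ => f ()) (ψ := id) (measurable_pi_apply _) measurable_id

/-- Gaussian integration by parts (Stein's lemma) for a Gaussian vector. -/
theorem integral_coord_mul_eq (hW : HasGaussianLaw W P) (h0 : ∫ ω, W ω k₀ ∂P = 0) (hv : 0 < v)
    (hvar : ∫ ω, W ω k₀ * W ω k₀ ∂P = v) (hcov : ∀ k, ∫ ω, W ω k * W ω k₀ ∂P = v * a k)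
    {Φ Φ' : (ι → ℝ) → ℝ} (hΦ : HasPolyDirDeriv a Φ Φ') :
    ∫ ω, W ω k₀ * Φ (W ω) ∂P = v * ∫ ω, Φ' (W ω) ∂P := by
  have := hW.isProbabilityMeasure
  have hX : HasGaussianLaw (fun ω => W ω k₀) P :=
    hW.map_of_measurable (.proj k₀) (measurable_pi_apply k₀)
  have hind := indepFun_residual hW h0 hvar hcov
  have hlaw : P.map (fun ω => W ω k₀) = gaussianReal 0 v.toNNReal := by
    rw [hX.map_eq_gaussianReal, h0, variance_of_integral_eq_zero hX.aemeasurable h0]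
    congr 2
    rw [← hvar]
    congr 1; ext ω; ring
  have hZm : AEMeasurable (fun ω => W ω - W ω k₀ • a) P := by
    have := hW.aemeasurable
    fun_prop
  have hprod := (indepFun_iff_map_prod_eq_prod_map_map hX.aemeasurable hZm).1 hind
  rw [hlaw] at hprod
  have hv' : v.toNNReal ≠ 0 := by simpa using hv
  -- Fubini for the independent pair (coordinate, residual). With the residual frozen at `z`, the
  -- vector moves along the line `z + x • a`, where the one-dimensional formula applies; `main` is
  -- used with `p = id` and with `p = 1`.
  have main : ∀ {p : ℝ → ℝ} {f : (ι → ℝ) → ℝ}, HasPolyGrowth p → HasPolyGrowth f →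
      ∫ ω, p (W ω k₀) * f (W ω) ∂P = ∫ z, ∫ x, p x * f (z + x • a) ∂(gaussianReal 0 v.toNNReal)
        ∂(P.map fun ω => W ω - W ω k₀ • a) := by
    intro p f hp hf
    have hint : Integrable (fun ω => p (W ω k₀) * f (W ω)) P :=
      ((hp.comp_coord k₀).mul hf).integrable_comp hW
    have hcont : Continuous (fun q : ℝ × (ι → ℝ) => p q.1 * f (q.2 + q.1 • a)) :=
      (hp.continuous.comp continuous_fst).mul (hf.continuous.comp (by fun_prop))
    have hpair : AEMeasurable (fun ω => (W ω k₀, W ω - W ω k₀ • a)) P :=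
      hX.aemeasurable.prodMk hZm
    have e1 : ∫ ω, p (W ω k₀) * f (W ω) ∂P
        = ∫ q, p q.1 * f (q.2 + q.1 • a)
          ∂(P.map fun ω => (W ω k₀, W ω - W ω k₀ • a)) := by
      rw [integral_map hpair hcont.aestronglyMeasurable]
      simp
    have i1 : Integrable (fun q : ℝ × (ι → ℝ) => p q.1 * f (q.2 + q.1 • a))
        (P.map fun ω => (W ω k₀, W ω - W ω k₀ • a)) := by
      rw [integrable_map_measure hcont.aestronglyMeasurable hpair]
      simpa [Function.comp_def] using hint
    have : IsProbabilityMeasure (P.map fun ω => W ω - W ω k₀ • a) :=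
      Measure.isProbabilityMeasure_map hZm
    rw [e1, hprod, integral_prod_symm]
    rwa [hprod] at i1
  have e2 := main HasPolyGrowth.id_real hΦ.left
  have e3 := main (HasPolyGrowth.const 1) hΦ.right
  simp only [one_mul] at e3
  rw [e2, e3, ← integral_const_mul]
  congr 1
  ext z
  rw [integral_mul_gaussianReal hv' (hΦ.left.comp_line z a) (hΦ.right.comp_line z a)
    (hΦ.deriv_line z), Real.coe_toNNReal _ hv.le]

end Stein

/-! ### Integration by parts against the third Hermite polynomial. -/

section Hermite

variable {ι : Type*} [Fintype ι] {Ω : Type*} [MeasurableSpace Ω] {P : Measure Ω}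
  {W : Ω → ι → ℝ} {k₀ : ι} {v : ℝ} {a : ι → ℝ}

/-- The first four entries of `p` are successive derivatives in the direction `a`. -/
def IsPolyChain (a : ι → ℝ) (p : ℕ → (ι → ℝ) → ℝ) : Prop :=
  ∀ k < 3, HasPolyDirDeriv a (p k) (p (k + 1))

/-- The sequence of derivatives of a product, by the Leibniz rule. -/
def leibniz (p q : ℕ → (ι → ℝ) → ℝ) (k : ℕ) (y : ι → ℝ) : ℝ :=
  ∑ l ∈ Finset.range (k + 1), (k.choose l : ℝ) * (p l y * q (k - l) y)

theorem IsPolyChain.mul {p q : ℕ → (ι → ℝ) → ℝ} (hp : IsPolyChain a p) (hq : IsPolyChain a q) :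
    IsPolyChain a (leibniz p q) := by
  have hp0 := hp 0 (by norm_num)
  have hp1 := hp 1 (by norm_num)
  have hp2 := hp 2 (by norm_num)
  have hq0 := hq 0 (by norm_num)
  have hq1 := hq 1 (by norm_num)
  have hq2 := hq 2 (by norm_num)
  intro k hk
  interval_cases k
  · refine (hp0.mul hq0).congr (fun y => ?_) (fun y => ?_) <;>
      simp [leibniz, Finset.sum_range_succ] <;> ring
  · refine ((hp1.mul hq0).add (hp0.mul hq1)).congr (fun y => ?_) (fun y => ?_) <;>
      simp [leibniz, Finset.sum_range_succ, Nat.choose] <;> ring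
  · refine ((hp2.mul hq0).add (((HasPolyDirDeriv.const 2).mul (hp1.mul hq1)).add
      (hp0.mul hq2))).congr (fun y => ?_) (fun y => ?_) <;>
      simp [leibniz, Finset.sum_range_succ, Nat.choose] <;> ring

theorem IsPolyChain.growth_three {p : ℕ → (ι → ℝ) → ℝ} (hp : IsPolyChain a p) :
    HasPolyGrowth (p 3) := (hp 2 (by norm_num)).right

/-- Integration by parts against the third Hermite polynomial. -/
theorem integral_hermite_three_mul_eq (hW : HasGaussianLaw W P) (h0 : ∫ ω, W ω k₀ ∂P = 0)
    (hv : 0 < v) (hvar : ∫ ω, W ω k₀ * W ω k₀ ∂P = v)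
    (hcov : ∀ k, ∫ ω, W ω k * W ω k₀ ∂P = v * a k)
    {p : ℕ → (ι → ℝ) → ℝ} (hp : IsPolyChain a p) :
    ∫ ω, (W ω k₀ ^ 3 - 3 * v * W ω k₀) * p 0 (W ω) ∂P = v ^ 3 * ∫ ω, p 3 (W ω) ∂P := by
  -- The direction is normalised so that the distinguished coordinate has derivative one.
  have ha : a k₀ = 1 := by
    have := hcov k₀
    rw [hvar] at this
    field_simp at this
    linarith
  have hp0 := hp 0 (by norm_num)
  have hp1 := hp 1 (by norm_num)
  have hp2 := hp 2 (by norm_num)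
  have hc : HasPolyDirDeriv a (fun y => y k₀) (fun _ => 1) := by
    simpa [ha] using HasPolyDirDeriv.coord (a := a) k₀
  have hI : ∀ {f : (ι → ℝ) → ℝ}, HasPolyGrowth f → Integrable (fun ω => f (W ω)) P :=
    fun hf => hf.integrable_comp hW
  have e1 := integral_coord_mul_eq hW h0 hv hvar hcov ((hc.mul hc).mul hp0)
  have e2 := integral_coord_mul_eq hW h0 hv hvar hcov hp0
  have e3 := integral_coord_mul_eq hW h0 hv hvar hcov (hc.mul hp1)
  have e4 := integral_coord_mul_eq hW h0 hv hvar hcov hp2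
  have i1 := hI (hc.left.mul ((hc.mul hc).mul hp0).left)
  have i2 := hI (hc.left.mul hp0.left)
  have i3 := hI (hc.left.mul (hc.mul hp1).left)
  have i4 := hI (hc.left.mul hp2.left)
  have i5 := hI hp1.left
  have f1 : ∫ ω, (W ω k₀ ^ 3 - 3 * v * W ω k₀) * p 0 (W ω) ∂P
      = ∫ ω, W ω k₀ * (W ω k₀ * W ω k₀ * p 0 (W ω)) ∂P
        - 3 * v * ∫ ω, W ω k₀ * p 0 (W ω) ∂P := by
    rw [← integral_const_mul, ← integral_sub i1 (i2.const_mul _)]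
    congr 1; ext ω; ring
  have f2 : ∫ ω, ((1 * W ω k₀ + W ω k₀ * 1) * p 0 (W ω) + W ω k₀ * W ω k₀ * p (0 + 1) (W ω)) ∂P
      = 2 * ∫ ω, W ω k₀ * p 0 (W ω) ∂P + ∫ ω, W ω k₀ * (W ω k₀ * p 1 (W ω)) ∂P := by
    rw [← integral_const_mul, ← integral_add (i2.const_mul _) i3]
    congr 1; ext ω; ring_nf
  have f3 : ∫ ω, (1 * p 1 (W ω) + W ω k₀ * p (1 + 1) (W ω)) ∂P
      = ∫ ω, p 1 (W ω) ∂P + ∫ ω, W ω k₀ * p 2 (W ω) ∂P := by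
    rw [← integral_add i5 i4]
    congr 1; ext ω; ring_nf
  -- The term `-3 v X` is exactly what cancels the lower-order terms, leaving only the third
  -- derivative.
  rw [f1, e1, f2, e3, f3, e4, e2]
  ring

theorem integral_coord_pow_four (hW : HasGaussianLaw W P) (h0 : ∫ ω, W ω k₀ ∂P = 0)
    (hv : 0 < v) (hvar : ∫ ω, W ω k₀ * W ω k₀ ∂P = v)
    (hcov : ∀ k, ∫ ω, W ω k * W ω k₀ ∂P = v * a k) :
    ∫ ω, W ω k₀ ^ 4 ∂P = 3 * v ^ 2 := by
  have ha : a k₀ = 1 := by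
    have := hcov k₀
    rw [hvar] at this
    field_simp at this
    linarith
  have hc : HasPolyDirDeriv a (fun y => y k₀) (fun _ => 1) := by
    simpa [ha] using HasPolyDirDeriv.coord (a := a) k₀
  have e := integral_coord_mul_eq hW h0 hv hvar hcov ((hc.mul hc).mul hc)
  have f1 : ∫ ω, W ω k₀ ^ 4 ∂P = ∫ ω, W ω k₀ * (W ω k₀ * W ω k₀ * W ω k₀) ∂P := by
    congr 1; ext ω; ring
  have f2 : ∫ ω, ((1 * W ω k₀ + W ω k₀ * 1) * W ω k₀ + W ω k₀ * W ω k₀ * 1) ∂P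
      = 3 * ∫ ω, W ω k₀ * W ω k₀ ∂P := by
    rw [← integral_const_mul]
    congr 1; ext ω; ring
  rw [f1, e, f2, hvar]
  ring

end Hermite

/-! ### Bounds for the expectation attached to a pair of summands. -/

section PairBounds

variable {g : ℕ → ℝ → ℝ} {M : ℝ}

/-- `g 0, …, g 3` are successive derivatives, all bounded by `M`. -/
structure IsBoundedJet (g : ℕ → ℝ → ℝ) (M : ℝ) : Prop where
  deriv : ∀ k < 3, ∀ x, HasDerivAt (g k) (g (k + 1) x) x
  continuous : ∀ k ≤ 3, Continuous (g k)
  bound : ∀ k ≤ 3, ∀ x, |g k x| ≤ M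

theorem IsBoundedJet.nonneg (hg : IsBoundedJet g M) : 0 ≤ M :=
  (abs_nonneg _).trans (hg.bound 0 (by norm_num) 0)

theorem IsBoundedJet.lipschitz (hg : IsBoundedJet g M) (x y : ℝ) :
    |g 0 x - g 0 y| ≤ M * |x - y| := by
  have := Convex.norm_image_sub_le_of_norm_hasDerivWithin_le (f := g 0) (f' := g 1) (s := Set.univ)
    (C := M) (x := y) (y := x) (fun z _ => (hg.deriv 0 (by norm_num) z).hasDerivWithinAt)
    (fun z _ => hg.bound 1 (by norm_num) z) convex_univ trivial trivial
  simpa using this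

/-- The successive derivatives of `y ↦ g (y i) - g (y j)` in the direction `a`. -/
def diffJet {ι : Type*} (g : ℕ → ℝ → ℝ) (a : ι → ℝ) (i j : ι) (k : ℕ) (y : ι → ℝ) : ℝ :=
  a i ^ k * g k (y i) - a j ^ k * g k (y j)

theorem IsBoundedJet.abs_diffJet_le {ι : Type*} {a : ι → ℝ} (hg : IsBoundedJet g M) {S : ℝ}
    {i j : ι} (hi : |a i| ≤ S) (hj : |a j| ≤ S) {k : ℕ} (hk : k ≤ 3) (y : ι → ℝ) :
    |diffJet g a i j k y| ≤ 2 * M * S ^ k := by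
  have h : ∀ i, |a i| ≤ S → |a i ^ k * g k (y i)| ≤ S ^ k * M := fun i hi => by
    rw [abs_mul, abs_pow]
    have := hg.bound k hk (y i)
    have := (abs_nonneg _).trans hi
    gcongr
  have := (abs_sub (a i ^ k * g k (y i)) (a j ^ k * g k (y j))).trans (add_le_add (h i hi) (h j hj))
  simp only [diffJet]
  linarith

variable {ι : Type*} [Fintype ι] {a b : ι → ℝ}

theorem IsBoundedJet.hasPolyDirDeriv_diffJet (hg : IsBoundedJet g M) (i j : ι) {k : ℕ}
    (hk : k < 3) :
    HasPolyDirDeriv b (diffJet g a i j k)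
      (fun y => a i ^ k * b i * g (k + 1) (y i) - a j ^ k * b j * g (k + 1) (y j)) := by
  have h : ∀ i, HasPolyDirDeriv b (fun y => g k (y i)) (fun y => b i * g (k + 1) (y i)) := fun i =>
    HasPolyDirDeriv.comp_coord (hg.deriv k hk) (hg.continuous (k + 1) (by omega))
      (hg.bound k (by omega)) (hg.bound (k + 1) (by omega)) i
  refine (((HasPolyDirDeriv.const (a i ^ k)).mul (h i)).sub
    ((HasPolyDirDeriv.const (a j ^ k)).mul (h j))).congr (fun y => ?_) (fun y => ?_)
  · simp [diffJet]
  · ring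

theorem IsBoundedJet.isPolyChain_diffJet (hg : IsBoundedJet g M) (i j : ι) :
    IsPolyChain a (diffJet g a i j) := fun k hk =>
  (hg.hasPolyDirDeriv_diffJet i j hk).congr (fun y => rfl) fun y => by
    simp only [diffJet]; ring

/-- The successive derivatives of the third Hermite polynomial of a coordinate. -/
def hermiteJet {ι : Type*} (v : ℝ) (a : ι → ℝ) (i : ι) (k : ℕ) (y : ι → ℝ) : ℝ :=
  match k with
  | 0 => y i ^ 3 - 3 * v * y i
  | 1 => a i * (3 * y i ^ 2 - 3 * v)
  | 2 => 6 * a i ^ 2 * y i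
  | 3 => 6 * a i ^ 3
  | _ => 0

theorem isPolyChain_hermiteJet (v : ℝ) (i : ι) : IsPolyChain a (hermiteJet v a i) := by
  have hc := HasPolyDirDeriv.coord (a := a) i
  have hk : ∀ c : ℝ, HasPolyDirDeriv a (fun _ => c) (fun _ => 0) := HasPolyDirDeriv.const
  intro k hk3
  interval_cases k
  · refine ((hc.mul (hc.mul hc)).sub ((hk (3 * v)).mul hc)).congr (fun y => ?_) (fun y => ?_) <;>
      simp only [hermiteJet] <;> ring
  · refine ((hk (a i)).mul (((hk 3).mul (hc.mul hc)).sub (hk (3 * v)))).congr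
      (fun y => ?_) (fun y => ?_) <;> simp only [hermiteJet] <;> ring
  · refine ((hk (6 * a i ^ 2)).mul hc).congr (fun y => ?_) (fun y => ?_) <;>
      simp only [hermiteJet] <;> ring

theorem abs_sum_four_le {A B C D A' B' C' D' : ℝ} (hA : |A| ≤ A') (hB : |B| ≤ B') (hC : |C| ≤ C')
    (hD : |D| ≤ D') : |A + B + C + D| ≤ A' + B' + C' + D' := by
  have h1 := abs_add_le (A + B + C) D
  have h2 := abs_add_le (A + B) C
  have h3 := abs_add_le A B
  linarith

theorem abs_mul_le {A B A' B' : ℝ} (hA : |A| ≤ A') (hB : |B| ≤ B') : |A * B| ≤ A' * B' := by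
  rw [abs_mul]
  exact mul_le_mul hA hB (abs_nonneg _) ((abs_nonneg _).trans hA)

/-- Here `X = |ΔB_j|`, `D = |β_i - β_c|`, `D' = |β_j - β_c|`. Every monomial is traded by AM-GM for
one whose mean is at most a constant times `e`; `v ≤ 1` absorbs `v X ^ 2` into `X ^ 2`. -/
theorem hermite_majorant_le {v : ℝ} (hv : 0 ≤ v) (hv1 : v ≤ 1) (X D D' : ℝ) :
    6 * (D * D') + 36 * (D + D') * X + 48 * (3 * X ^ 2 + 3 * v) + 32 * (X ^ 3 + 3 * v * X) ≤
      244 * (X * X) + 16 * X ^ 4 + 192 * v + 21 * (D ^ 2 + D' ^ 2) := by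
  have h1 := sq_nonneg (D - D')
  have h2 := sq_nonneg (D - X)
  have h3 := sq_nonneg (D' - X)
  have h4 := sq_nonneg (X - X ^ 2)
  have h5 := mul_nonneg hv (sq_nonneg (X - 1))
  have h6 := mul_nonneg (sub_nonneg.2 hv1) (sq_nonneg X)
  linarith

/-- Each of the three derivatives yields one coefficient of `a`, wherever it falls, so all Leibniz
terms share the factor `S ^ 3`. Undifferentiated differences of `g` are bounded by the Lipschitz
estimate where smallness is needed; elsewhere the bound `2 * M` suffices because a positive power of
`X` or `v` remains. -/
theorem IsBoundedJet.abs_leibniz_hermite_le {ι : Type*} {a : ι → ℝ} (hg : IsBoundedJet g M)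
    {S v : ℝ} {i j c l : ι}
    (hi : |a i| ≤ S) (hj : |a j| ≤ S) (hc : |a c| ≤ S) (hl : |a l| ≤ S) (hv : 0 ≤ v) (hv1 : v ≤ 1)
    (y : ι → ℝ) :
    |leibniz (leibniz (diffJet g a i c) (diffJet g a j c)) (hermiteJet v a l) 3 y| ≤
      M ^ 2 * S ^ 3 * (244 * (y l * y l) + 16 * y l ^ 4 + 192 * v
        + 21 * ((y i - y c) ^ 2 + (y j - y c) ^ 2)) := by
  have hM := hg.nonneg
  have hS : 0 ≤ S := (abs_nonneg _).trans hi
  set F := leibniz (diffJet g a i c) (diffJet g a j c) with hF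
  have hp : ∀ k ≤ 3, |diffJet g a i c k y| ≤ 2 * M * S ^ k := fun k hk =>
    hg.abs_diffJet_le hi hc hk y
  have hq : ∀ k ≤ 3, |diffJet g a j c k y| ≤ 2 * M * S ^ k := fun k hk =>
    hg.abs_diffJet_le hj hc hk y
  have hp0 : |diffJet g a i c 0 y| ≤ M * |y i - y c| := by
    simpa [diffJet] using hg.lipschitz (y i) (y c)
  have hq0 : |diffJet g a j c 0 y| ≤ M * |y j - y c| := by
    simpa [diffJet] using hg.lipschitz (y j) (y c)
  have hF3 : |F 3 y| ≤ 32 * M ^ 2 * S ^ 3 := by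
    have e : F 3 y = diffJet g a i c 0 y * diffJet g a j c 3 y
        + 3 * (diffJet g a i c 1 y * diffJet g a j c 2 y)
        + 3 * (diffJet g a i c 2 y * diffJet g a j c 1 y)
        + diffJet g a i c 3 y * diffJet g a j c 0 y := by
      simp [hF, leibniz, Finset.sum_range_succ, Nat.choose]
    rw [e]
    refine (abs_sum_four_le (abs_mul_le (hp 0 (by norm_num)) (hq 3 (by norm_num)))
      (abs_mul_le (abs_of_pos (by norm_num)).le
        (abs_mul_le (hp 1 (by norm_num)) (hq 2 (by norm_num))))
      (abs_mul_le (abs_of_pos (by norm_num)).le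
        (abs_mul_le (hp 2 (by norm_num)) (hq 1 (by norm_num))))
      (abs_mul_le (hp 3 (by norm_num)) (hq 0 (by norm_num)))).trans_eq ?_
    ring
  have hF2 : |F 2 y| ≤ 16 * M ^ 2 * S ^ 2 := by
    have e : F 2 y = diffJet g a i c 0 y * diffJet g a j c 2 y
        + 2 * (diffJet g a i c 1 y * diffJet g a j c 1 y)
        + diffJet g a i c 2 y * diffJet g a j c 0 y + 0 := by
      simp [hF, leibniz, Finset.sum_range_succ, Nat.choose]
    rw [e]
    refine (abs_sum_four_le (abs_mul_le (hp 0 (by norm_num)) (hq 2 (by norm_num)))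
      (abs_mul_le (abs_of_pos (by norm_num)).le
        (abs_mul_le (hp 1 (by norm_num)) (hq 1 (by norm_num))))
      (abs_mul_le (hp 2 (by norm_num)) (hq 0 (by norm_num))) abs_zero.le).trans_eq ?_
    ring
  have hF1 : |F 1 y| ≤ 2 * M ^ 2 * S * (|y i - y c| + |y j - y c|) := by
    have e : F 1 y = diffJet g a i c 0 y * diffJet g a j c 1 y
        + diffJet g a i c 1 y * diffJet g a j c 0 y + 0 + 0 := by
      simp [hF, leibniz, Finset.sum_range_succ]
    rw [e]
    refine (abs_sum_four_le (abs_mul_le hp0 (hq 1 (by norm_num)))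
      (abs_mul_le (hp 1 (by norm_num)) hq0) abs_zero.le abs_zero.le).trans_eq ?_
    ring
  have hF0 : |F 0 y| ≤ M ^ 2 * (|y i - y c| * |y j - y c|) := by
    have e : F 0 y = diffJet g a i c 0 y * diffJet g a j c 0 y := by
      simp [hF, leibniz]
    rw [e]
    refine (abs_mul_le hp0 hq0).trans_eq ?_
    ring
  set x := y l
  have hh0 : |hermiteJet v a l 0 y| ≤ |x| ^ 3 + 3 * v * |x| := by
    refine (abs_sub _ _).trans_eq ?_
    rw [abs_pow, abs_mul, abs_of_nonneg (by positivity : 0 ≤ 3 * v)]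
  have hh1 : |hermiteJet v a l 1 y| ≤ S * (3 * |x| ^ 2 + 3 * v) := by
    refine abs_mul_le hl ((abs_sub _ _).trans_eq ?_)
    rw [abs_of_nonneg (by positivity : 0 ≤ 3 * v), abs_of_nonneg (by positivity), sq_abs]
  have hh2 : |hermiteJet v a l 2 y| ≤ 6 * S ^ 2 * |x| := by
    refine abs_mul_le (abs_mul_le (abs_of_pos (by norm_num)).le ?_) le_rfl
    rw [abs_pow]
    gcongr
  have hh3 : |hermiteJet v a l 3 y| ≤ 6 * S ^ 3 := by
    refine abs_mul_le (abs_of_pos (by norm_num)).le ?_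
    rw [abs_pow]
    gcongr
  have e : leibniz F (hermiteJet v a l) 3 y = F 0 y * hermiteJet v a l 3 y
      + 3 * (F 1 y * hermiteJet v a l 2 y) + 3 * (F 2 y * hermiteJet v a l 1 y)
      + F 3 y * hermiteJet v a l 0 y := by
    simp [leibniz, Finset.sum_range_succ, Nat.choose]
  rw [e]
  refine (abs_sum_four_le (abs_mul_le hF0 hh3)
    (abs_mul_le (abs_of_pos (by norm_num)).le (abs_mul_le hF1 hh2))
    (abs_mul_le (abs_of_pos (by norm_num)).le (abs_mul_le hF2 hh1))
    (abs_mul_le hF3 hh0)).trans ?_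
  rw [← sq_abs (y i - y c), ← sq_abs (y j - y c), ← abs_mul_abs_self x,
    ← Even.pow_abs (by decide : Even 4) x]
  set X := |x|
  set D := |y i - y c|
  set D' := |y j - y c|
  have key := hermite_majorant_le hv hv1 X D D'
  have := mul_le_mul_of_nonneg_left key (by positivity : 0 ≤ M ^ 2 * S ^ 3)
  refine le_trans (le_of_eq ?_) this
  ring

variable {Ω : Type*} [MeasurableSpace Ω] {P : Measure Ω} {W : Ω → ι → ℝ} {i j c k l : ι} {v e : ℝ}

theorem IsBoundedJet.abs_integral_hermite_pair_le (hg : IsBoundedJet g M) {S : ℝ}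
    (hW : HasGaussianLaw W P) (hv : 0 < v) (hv1 : v ≤ 1) (hve : v ≤ e)
    (hk0 : ∫ ω, W ω k ∂P = 0) (hk : ∫ ω, W ω k * W ω k ∂P = v)
    (hl0 : ∫ ω, W ω l ∂P = 0) (hl : ∫ ω, W ω l * W ω l ∂P = v)
    (ha : ∀ r, ∫ ω, W ω r * W ω k ∂P = v * a r)
    (hic : ∫ ω, (W ω i - W ω c) ^ 2 ∂P ≤ e) (hjc : ∫ ω, (W ω j - W ω c) ^ 2 ∂P ≤ e)
    (hai : |a i| ≤ S) (haj : |a j| ≤ S) (hac : |a c| ≤ S) (hal : |a l| ≤ S) :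
    |∫ ω, (g 0 (W ω i) - g 0 (W ω c)) * (W ω k ^ 3 - 3 * v * W ω k) *
        ((g 0 (W ω j) - g 0 (W ω c)) * (W ω l ^ 3 - 3 * v * W ω l)) ∂P| ≤
      526 * M ^ 2 * (v ^ 3 * e * S ^ 3) := by
  have := hW.isProbabilityMeasure
  have hM := hg.nonneg
  have hS : 0 ≤ S := (abs_nonneg _).trans hai
  have hchain : IsPolyChain a
      (leibniz (leibniz (diffJet g a i c) (diffJet g a j c)) (hermiteJet v a l)) :=
    ((hg.isPolyChain_diffJet i c).mul (hg.isPolyChain_diffJet j c)).mul (isPolyChain_hermiteJet v l)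
  -- The fourth moment needs the regression direction of the coordinate `l`, not `a`.
  have h4 : ∫ ω, W ω l ^ 4 ∂P = 3 * v ^ 2 :=
    integral_coord_pow_four (a := fun r => (∫ ω, W ω r * W ω l ∂P) / v) hW hl0 hv hl
      (fun r => by field_simp)
  have key := integral_hermite_three_mul_eq hW hk0 hv hk ha hchain
  have e1 : ∫ ω, (g 0 (W ω i) - g 0 (W ω c)) * (W ω k ^ 3 - 3 * v * W ω k) *
        ((g 0 (W ω j) - g 0 (W ω c)) * (W ω l ^ 3 - 3 * v * W ω l)) ∂P
      = ∫ ω, (W ω k ^ 3 - 3 * v * W ω k) *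
        leibniz (leibniz (diffJet g a i c) (diffJet g a j c)) (hermiteJet v a l) 0 (W ω) ∂P := by
    congr 1; ext ω
    simp [leibniz, diffJet, hermiteJet]
    ring
  rw [e1, key, abs_mul, abs_of_pos (by positivity)]
  have hI : ∀ {f : (ι → ℝ) → ℝ}, HasPolyGrowth f → Integrable (fun ω => f (W ω)) P :=
    fun hf => hf.integrable_comp hW
  have i1 := hI ((HasPolyGrowth.coord l).mul (HasPolyGrowth.coord l))
  have i2 := hI ((HasPolyGrowth.coord l).pow 4)
  have i3 := hI (((HasPolyGrowth.coord i).sub (HasPolyGrowth.coord c)).pow 2)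
  have i4 := hI (((HasPolyGrowth.coord j).sub (HasPolyGrowth.coord c)).pow 2)
  have b1 : |∫ ω, leibniz (leibniz (diffJet g a i c) (diffJet g a j c)) (hermiteJet v a l) 3
      (W ω) ∂P| ≤ ∫ ω, M ^ 2 * S ^ 3 * (244 * (W ω l * W ω l) + 16 * W ω l ^ 4 + 192 * v
        + 21 * ((W ω i - W ω c) ^ 2 + (W ω j - W ω c) ^ 2)) ∂P := by
    refine abs_integral_le_integral_abs.trans (integral_mono (hI hchain.growth_three).abs ?_
      fun ω => hg.abs_leibniz_hermite_le hai haj hac hal hv.le hv1 (W ω))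
    exact ((((i1.const_mul 244).add (i2.const_mul 16)).add (integrable_const _)).add
      ((i3.add i4).const_mul 21)).const_mul _
  have b2 : ∫ ω, M ^ 2 * S ^ 3 * (244 * (W ω l * W ω l) + 16 * W ω l ^ 4 + 192 * v
        + 21 * ((W ω i - W ω c) ^ 2 + (W ω j - W ω c) ^ 2)) ∂P
      = M ^ 2 * S ^ 3 * (244 * v + 16 * (3 * v ^ 2) + 192 * v
        + 21 * (∫ ω, (W ω i - W ω c) ^ 2 ∂P + ∫ ω, (W ω j - W ω c) ^ 2 ∂P)) := by
    have j1 : Integrable (fun ω => 244 * (W ω l * W ω l) + 16 * W ω l ^ 4) P :=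
      (i1.const_mul 244).add (i2.const_mul 16)
    have j2 : Integrable (fun ω => 244 * (W ω l * W ω l) + 16 * W ω l ^ 4 + 192 * v) P :=
      j1.add (integrable_const _)
    have j3 : Integrable (fun ω => 21 * ((W ω i - W ω c) ^ 2 + (W ω j - W ω c) ^ 2)) P :=
      (i3.add i4).const_mul 21
    rw [integral_const_mul, integral_add j2 j3, integral_add j1 (integrable_const _),
      integral_add (i1.const_mul 244) (i2.const_mul 16), integral_const_mul, integral_const_mul,
      integral_const_mul 21, integral_add i3 i4, hl, h4]
    simp
  -- With `v ^ 2 ≤ v ≤ e`: `244 + 48 + 192 + 42 = 526`.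
  have b3 : 244 * v + 16 * (3 * v ^ 2) + 192 * v
        + 21 * (∫ ω, (W ω i - W ω c) ^ 2 ∂P + ∫ ω, (W ω j - W ω c) ^ 2 ∂P) ≤ 526 * e := by
    nlinarith
  calc _ ≤ v ^ 3 * (M ^ 2 * S ^ 3 * (526 * e)) := by
        rw [b2] at b1
        gcongr
        exact b1.trans (by gcongr)
    _ = _ := by ring

/-- Integrating by parts against `W k` either hits the factor `W l`, giving `a l` times the mean of
a product of two Lipschitz differences, or hits that product. In the second case `W l` is still
available for an integration along `b`, whose extra factor `v` is at most `e`. -/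
theorem IsBoundedJet.abs_integral_linear_pair_le (hg : IsBoundedJet g M) {S S' : ℝ}
    (hW : HasGaussianLaw W P) (hv : 0 < v) (hve : v ≤ e)
    (hk0 : ∫ ω, W ω k ∂P = 0) (hk : ∫ ω, W ω k * W ω k ∂P = v)
    (hl0 : ∫ ω, W ω l ∂P = 0) (hl : ∫ ω, W ω l * W ω l ∂P = v)
    (ha : ∀ r, ∫ ω, W ω r * W ω k ∂P = v * a r) (hb : ∀ r, ∫ ω, W ω r * W ω l ∂P = v * b r)
    (hic : ∫ ω, (W ω i - W ω c) ^ 2 ∂P ≤ e) (hjc : ∫ ω, (W ω j - W ω c) ^ 2 ∂P ≤ e)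
    (hai : |a i| ≤ S) (haj : |a j| ≤ S) (hac : |a c| ≤ S)
    (hbi : |b i| ≤ S') (hbj : |b j| ≤ S') (hbc : |b c| ≤ S') :
    |∫ ω, (g 0 (W ω i) - g 0 (W ω c)) * (v * W ω k) *
        ((g 0 (W ω j) - g 0 (W ω c)) * (v * W ω l)) ∂P| ≤
      M ^ 2 * (v ^ 3 * e * (16 * (S * S') + |a l|)) := by
  have := hW.isProbabilityMeasure
  have hM := hg.nonneg
  have hS : 0 ≤ S := (abs_nonneg _).trans hai
  have hS' : 0 ≤ S' := (abs_nonneg _).trans hbi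
  have he : 0 ≤ e := hv.le.trans hve
  have hI : ∀ {f : (ι → ℝ) → ℝ}, HasPolyGrowth f → Integrable (fun ω => f (W ω)) P :=
    fun hf => hf.integrable_comp hW
  have hp := hg.isPolyChain_diffJet (a := a) i c
  have hq := hg.isPolyChain_diffJet (a := a) j c
  have hF := (hp 0 (by norm_num)).mul (hq 0 (by norm_num))
  have hpb : ∀ r < 3, _ := fun r hr => hg.hasPolyDirDeriv_diffJet (a := a) (b := b) i c hr
  have hqb : ∀ r < 3, _ := fun r hr => hg.hasPolyDirDeriv_diffJet (a := a) (b := b) j c hr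
  have hF' := ((hpb 1 (by norm_num)).mul (hqb 0 (by norm_num))).add
    ((hpb 0 (by norm_num)).mul (hqb 1 (by norm_num)))
  have e1 := integral_coord_mul_eq hW hk0 hv hk ha (hF.mul (HasPolyDirDeriv.coord l))
  have e2 := integral_coord_mul_eq hW hl0 hv hl hb hF'
  have e0 : ∫ ω, (g 0 (W ω i) - g 0 (W ω c)) * (v * W ω k) *
        ((g 0 (W ω j) - g 0 (W ω c)) * (v * W ω l)) ∂P
      = v ^ 2 * ∫ ω, W ω k * (diffJet g a i c 0 (W ω) * diffJet g a j c 0 (W ω) * W ω l) ∂P := by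
    rw [← integral_const_mul]
    congr 1; ext ω
    simp [diffJet]
    ring
  have i1 := hI ((HasPolyGrowth.coord l).mul hF'.left)
  have i2 := hI hF.left
  have e3 : ∫ ω, ((diffJet g a i c (0 + 1) (W ω) * diffJet g a j c 0 (W ω)
        + diffJet g a i c 0 (W ω) * diffJet g a j c (0 + 1) (W ω)) * W ω l
        + diffJet g a i c 0 (W ω) * diffJet g a j c 0 (W ω) * a l) ∂P
      = ∫ ω, W ω l * (diffJet g a i c 1 (W ω) * diffJet g a j c 0 (W ω)
        + diffJet g a i c 0 (W ω) * diffJet g a j c 1 (W ω)) ∂P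
        + a l * ∫ ω, diffJet g a i c 0 (W ω) * diffJet g a j c 0 (W ω) ∂P := by
    rw [← integral_const_mul, ← integral_add i1 (i2.const_mul _)]
    congr 1; ext ω; ring_nf
  rw [e0, e1, e3, e2]
  have hterm : ∀ (r s : ι) (n m : ℕ) (y : ι → ℝ), n ≤ 1 → m ≤ 3 → |a r| ≤ S → |b r| ≤ S' →
      |a r ^ n * b r * g m (y r)| ≤ S ^ n * S' * M := by
    intro r s n m y _ hm h1 h2
    refine abs_mul_le (abs_mul_le ?_ h2) (hg.bound m hm _)
    rw [abs_pow]
    gcongr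
  have hder : ∀ (r : ι) (n : ℕ) (y : ι → ℝ), n ≤ 1 → |a r| ≤ S → |b r| ≤ S' →
      |a r ^ n * b r * g (n + 1) (y r) - a c ^ n * b c * g (n + 1) (y c)| ≤ 2 * M * (S ^ n * S') := by
    intro r n y hn h1 h2
    refine (abs_sub _ _).trans ((add_le_add (hterm r r n (n + 1) y hn (by omega) h1 h2)
      (hterm c c n (n + 1) y hn (by omega) hac hbc)).trans_eq (by ring))
  have b1 : |∫ ω, diffJet g a i c 0 (W ω) * diffJet g a j c 0 (W ω) ∂P| ≤ M ^ 2 * e := by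
    -- The Lipschitz bound followed by `2 x y ≤ x ^ 2 + y ^ 2` reduces the mean to the two second
    -- moments.
    have i3 := hI (((HasPolyGrowth.coord i).sub (HasPolyGrowth.coord c)).pow 2)
    have i4 := hI (((HasPolyGrowth.coord j).sub (HasPolyGrowth.coord c)).pow 2)
    have : |∫ ω, diffJet g a i c 0 (W ω) * diffJet g a j c 0 (W ω) ∂P| ≤
        ∫ ω, M ^ 2 / 2 * ((W ω i - W ω c) ^ 2 + (W ω j - W ω c) ^ 2) ∂P := by
      refine abs_integral_le_integral_abs.trans (integral_mono i2.abs ((i3.add i4).const_mul _)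
        fun ω => ?_)
      have h1 : |diffJet g a i c 0 (W ω)| ≤ M * |W ω i - W ω c| := by
        simpa [diffJet] using hg.lipschitz (W ω i) (W ω c)
      have h2 : |diffJet g a j c 0 (W ω)| ≤ M * |W ω j - W ω c| := by
        simpa [diffJet] using hg.lipschitz (W ω j) (W ω c)
      refine (abs_mul_le h1 h2).trans ?_
      rw [← sq_abs (W ω i - W ω c), ← sq_abs (W ω j - W ω c)]
      nlinarith [mul_nonneg (sq_nonneg M) (sq_nonneg (|W ω i - W ω c| - |W ω j - W ω c|))]
    rw [integral_const_mul, integral_add i3 i4] at this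
    refine this.trans ?_
    nlinarith [sq_nonneg M]
  have b2 : |∫ ω, ((a i ^ 1 * b i * g (1 + 1) (W ω i) - a c ^ 1 * b c * g (1 + 1) (W ω c))
        * diffJet g a j c 0 (W ω) + diffJet g a i c 1 (W ω)
          * (a j ^ 0 * b j * g (0 + 1) (W ω j) - a c ^ 0 * b c * g (0 + 1) (W ω c))
        + ((a i ^ 0 * b i * g (0 + 1) (W ω i) - a c ^ 0 * b c * g (0 + 1) (W ω c))
        * diffJet g a j c 1 (W ω) + diffJet g a i c 0 (W ω)
          * (a j ^ 1 * b j * g (1 + 1) (W ω j) - a c ^ 1 * b c * g (1 + 1) (W ω c)))) ∂P|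
      ≤ 16 * M ^ 2 * (S * S') := by
    have := norm_integral_le_of_norm_le_const (μ := P) (C := 16 * M ^ 2 * (S * S'))
      (Filter.Eventually.of_forall fun ω => ?_) (f := fun ω =>
        ((a i ^ 1 * b i * g (1 + 1) (W ω i) - a c ^ 1 * b c * g (1 + 1) (W ω c))
        * diffJet g a j c 0 (W ω) + diffJet g a i c 1 (W ω)
          * (a j ^ 0 * b j * g (0 + 1) (W ω j) - a c ^ 0 * b c * g (0 + 1) (W ω c))
        + ((a i ^ 0 * b i * g (0 + 1) (W ω i) - a c ^ 0 * b c * g (0 + 1) (W ω c))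
        * diffJet g a j c 1 (W ω) + diffJet g a i c 0 (W ω)
          * (a j ^ 1 * b j * g (1 + 1) (W ω j) - a c ^ 1 * b c * g (1 + 1) (W ω c)))))
    · simpa using this
    · rw [Real.norm_eq_abs, ← add_assoc]
      refine (abs_sum_four_le
        (abs_mul_le (hder i 1 _ le_rfl hai hbi) (hg.abs_diffJet_le haj hac (by norm_num) _))
        (abs_mul_le (hg.abs_diffJet_le hai hac (by norm_num) _) (hder j 0 _ (by norm_num) haj hbj))
        (abs_mul_le (hder i 0 _ (by norm_num) hai hbi) (hg.abs_diffJet_le haj hac (by norm_num) _))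
        (abs_mul_le (hg.abs_diffJet_le hai hac (by norm_num) _)
          (hder j 1 _ le_rfl haj hbj))).trans_eq ?_
      ring
  rw [abs_mul, abs_mul, abs_of_pos hv, abs_of_nonneg (by positivity : 0 ≤ v ^ 2)]
  calc _ ≤ v ^ 2 * (v * (e * (16 * M ^ 2 * (S * S')) + |a l| * (M ^ 2 * e))) := by
        gcongr
        refine (abs_add_le _ _).trans (add_le_add ?_ ?_)
        · rw [abs_mul, abs_of_pos hv]
          gcongr
        · rw [abs_mul]
          gcongr
    _ = _ := by ring

end PairBounds

/-! ### First and second differences of the absolute cube root. -/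

/-- The function `|x| ^ (1/3)`. -/
noncomputable def absCbrt (x : ℝ) : ℝ := |x| ^ (1 / 3 : ℝ)

theorem absCbrt_nonneg (x : ℝ) : 0 ≤ absCbrt x := by unfold absCbrt; positivity

theorem absCbrt_pow_three (x : ℝ) : absCbrt x ^ 3 = |x| := by
  rw [absCbrt, ← Real.rpow_natCast, ← Real.rpow_mul (abs_nonneg x)]
  norm_num

theorem absCbrt_neg (x : ℝ) : absCbrt (-x) = absCbrt x := by simp [absCbrt]

theorem absCbrt_sub_comm (x y : ℝ) : absCbrt (x - y) = absCbrt (y - x) := by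
  simp [absCbrt, abs_sub_comm]

@[simp] theorem absCbrt_zero : absCbrt 0 = 0 := by simp [absCbrt]

@[simp] theorem absCbrt_one : absCbrt 1 = 1 := by simp [absCbrt]

theorem absCbrt_mul (x y : ℝ) : absCbrt (x * y) = absCbrt x * absCbrt y := by
  rw [absCbrt, abs_mul, Real.mul_rpow (abs_nonneg _) (abs_nonneg _)]; rfl

theorem absCbrt_le {x y : ℝ} (h : |x| ≤ |y|) : absCbrt x ≤ absCbrt y :=
  Real.rpow_le_rpow (abs_nonneg _) h (by norm_num)

theorem one_le_absCbrt {x : ℝ} (h : 1 ≤ |x|) : 1 ≤ absCbrt x := by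
  have := absCbrt_le (x := 1) (y := x) (by simpa using h)
  simpa using this

/-- The decay profile `(1 + |x|) ^ (-2/3)`. -/
noncomputable def cbrtDecay (x : ℝ) : ℝ := (absCbrt (1 + |x|) ^ 2)⁻¹

theorem one_le_absCbrt_one_add_abs (x : ℝ) : 1 ≤ absCbrt (1 + |x|) :=
  one_le_absCbrt ((le_add_of_nonneg_right (abs_nonneg x)).trans (le_abs_self _))

theorem cbrtDecay_pos (x : ℝ) : 0 < cbrtDecay x := by
  have := one_le_absCbrt_one_add_abs x
  unfold cbrtDecay; positivity

theorem cbrtDecay_le_one (x : ℝ) : cbrtDecay x ≤ 1 :=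
  inv_le_one_of_one_le₀ (one_le_pow₀ (one_le_absCbrt_one_add_abs x))

theorem cbrtDecay_neg (x : ℝ) : cbrtDecay (-x) = cbrtDecay x := by simp [cbrtDecay]

theorem cbrtDecay_sub_comm (x y : ℝ) : cbrtDecay (x - y) = cbrtDecay (y - x) := by
  simp [cbrtDecay, abs_sub_comm]

theorem cbrtDecay_anti {x y : ℝ} (h : |x| ≤ |y|) : cbrtDecay y ≤ cbrtDecay x := by
  have h1 := one_le_absCbrt_one_add_abs x
  have h2 : absCbrt (1 + |x|) ≤ absCbrt (1 + |y|) := by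
    refine absCbrt_le ?_
    rw [abs_of_pos (by positivity : 0 < 1 + |x|), abs_of_pos (by positivity : 0 < 1 + |y|)]
    linarith
  unfold cbrtDecay
  gcongr

theorem absCbrt_sq_le_mul {k : ℝ} (hk : 1 ≤ k) {x y : ℝ} (h : |x| ≤ k * |y|) :
    absCbrt x ^ 2 ≤ k * absCbrt y ^ 2 := by
  have h1 : absCbrt x ≤ absCbrt k * absCbrt y := by
    rw [← absCbrt_mul]
    exact absCbrt_le (by rwa [abs_mul, abs_of_nonneg (by linarith : 0 ≤ k)])
  have h2 : 1 ≤ absCbrt k := one_le_absCbrt (hk.trans (le_abs_self _))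
  have h3 : absCbrt k ^ 2 ≤ k := by
    calc absCbrt k ^ 2 ≤ absCbrt k ^ 3 := pow_le_pow_right₀ h2 (by norm_num)
      _ = k := by rw [absCbrt_pow_three, abs_of_nonneg (by linarith)]
  calc absCbrt x ^ 2 ≤ (absCbrt k * absCbrt y) ^ 2 := by
        have := absCbrt_nonneg x
        gcongr
    _ = absCbrt k ^ 2 * absCbrt y ^ 2 := by ring
    _ ≤ k * absCbrt y ^ 2 := by gcongr

theorem cbrtDecay_sub_one_le (x : ℝ) : cbrtDecay (x - 1) ≤ 2 * cbrtDecay x := by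
  have h1 := one_le_absCbrt_one_add_abs x
  have h2 := one_le_absCbrt_one_add_abs (x - 1)
  have h : absCbrt (1 + |x|) ^ 2 ≤ 2 * absCbrt (1 + |x - 1|) ^ 2 := by
    refine absCbrt_sq_le_mul (by norm_num) ?_
    rw [abs_of_pos (by positivity : 0 < 1 + |x|), abs_of_pos (by positivity : 0 < 1 + |x - 1|)]
    have := abs_add_le (x - 1) 1
    simp only [sub_add_cancel, abs_one] at this
    linarith [abs_nonneg (x - 1)]
  unfold cbrtDecay
  rw [← div_eq_mul_inv, inv_eq_one_div, div_le_div_iff₀ (by positivity) (by positivity)]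
  linarith

/-- The forward difference of `absCbrt`. -/
noncomputable def cbrtDiff (x : ℝ) : ℝ := absCbrt (x + 1) - absCbrt x

theorem cbrtDiff_neg_sub_one (x : ℝ) : cbrtDiff (-x - 1) = -cbrtDiff x := by
  unfold cbrtDiff
  rw [show -x - 1 + 1 = -x by ring, show -x - 1 = -(x + 1) by ring, absCbrt_neg, absCbrt_neg]
  ring

/-- With `u, w` the cube roots, `(u - w) (u ^ 2 + u w + w ^ 2) = u ^ 3 - w ^ 3` has absolute value
at most one, and the quadratic factor is comparable to `(1 + |x|)^(2/3)`. -/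
theorem abs_cbrtDiff_le (x : ℝ) : |cbrtDiff x| ≤ 3 * cbrtDecay x := by
  set u := absCbrt (x + 1) with hu
  set w := absCbrt x with hw
  have hu0 : 0 ≤ u := absCbrt_nonneg _
  have hw0 : 0 ≤ w := absCbrt_nonneg _
  have hu3 : u ^ 3 = |x + 1| := absCbrt_pow_three _
  have hw3 : w ^ 3 = |x| := absCbrt_pow_three _
  have h1 := one_le_absCbrt_one_add_abs x
  have hd : |u - w| * (u ^ 2 + u * w + w ^ 2) ≤ 1 := by
    have e : |u - w| * (u ^ 2 + u * w + w ^ 2) = |(|x + 1| - |x|)| := by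
      rw [← hu3, ← hw3, ← abs_of_nonneg (by positivity : 0 ≤ u ^ 2 + u * w + w ^ 2), ← abs_mul]
      congr 1; ring
    rw [e]
    refine (abs_abs_sub_abs_le _ _).trans ?_
    simp
  have hm : absCbrt (1 + |x|) ^ 2 ≤ 3 * (u ^ 2 + u * w + w ^ 2) := by
    -- Equality holds at `x = -1/2`, which is where the constant 3 comes from.
    have key : 1 + |x| ≤ 3 * max |x + 1| |x| := by
      rcases abs_cases x with h | h <;> rcases abs_cases (x + 1) with h' | h' <;>
        rcases max_cases |x + 1| |x| with h'' | h'' <;> linarith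
    have hp : 0 < 1 + |x| := by positivity
    rcases max_cases |x + 1| |x| with h | h
    · have := absCbrt_sq_le_mul (by norm_num : (1 : ℝ) ≤ 3) (x := 1 + |x|) (y := x + 1)
        (by rw [abs_of_pos hp]; linarith)
      nlinarith [mul_nonneg hu0 hw0]
    · have := absCbrt_sq_le_mul (by norm_num : (1 : ℝ) ≤ 3) (x := 1 + |x|) (y := x)
        (by rw [abs_of_pos hp]; linarith)
      nlinarith [mul_nonneg hu0 hw0]
  unfold cbrtDiff cbrtDecay
  rw [← div_eq_mul_inv, le_div_iff₀ (by positivity)]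
  calc |u - w| * absCbrt (1 + |x|) ^ 2 ≤ |u - w| * (3 * (u ^ 2 + u * w + w ^ 2)) := by gcongr
    _ ≤ 3 := by linarith

/-- The two consecutive differences are the reciprocals of the quadratic factors `α` and `β`, and `α
- β` contains the factor `u - w`, which is itself small. -/
theorem abs_cbrtDiff_sub_le_of_one_le {x : ℝ} (hx : 1 ≤ x) :
    |cbrtDiff x - cbrtDiff (x - 1)| ≤ 24 * cbrtDecay x ^ 2 := by
  unfold cbrtDiff cbrtDecay
  rw [sub_add_cancel, abs_of_nonneg (by linarith : 0 ≤ x), add_comm 1 x]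
  set u := absCbrt (x + 1)
  set s := absCbrt x
  set w := absCbrt (x - 1)
  have hu3 : u ^ 3 = x + 1 := by rw [absCbrt_pow_three, abs_of_nonneg (by linarith)]
  have hs3 : s ^ 3 = x := by rw [absCbrt_pow_three, abs_of_nonneg (by linarith)]
  have hw3 : w ^ 3 = x - 1 := by rw [absCbrt_pow_three, abs_of_nonneg (by linarith)]
  have hs1 : 1 ≤ s := one_le_absCbrt (hx.trans (le_abs_self _))
  have hw0 : 0 ≤ w := absCbrt_nonneg _
  have hus : s ≤ u := absCbrt_le (by
    rw [abs_of_nonneg (by linarith : 0 ≤ x), abs_of_nonneg (by linarith)]; linarith)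
  have hsw : w ≤ s := absCbrt_le (by
    rw [abs_of_nonneg (by linarith : 0 ≤ x), abs_of_nonneg (by linarith)]; linarith)
  have hu2 : u ≤ 2 * s := by
    by_contra! h
    have : (2 * s) ^ 3 < u ^ 3 := by gcongr
    nlinarith
  set α := u ^ 2 + u * s + s ^ 2 with hα
  set β := s ^ 2 + s * w + w ^ 2 with hβ
  have hα1 : (u - s) * α = 1 := by rw [hα]; linear_combination hu3 - hs3
  have hβ1 : (s - w) * β = 1 := by rw [hβ]; linear_combination hs3 - hw3
  have hγ : (u - w) * (u ^ 2 + u * w + w ^ 2) = 2 := by linear_combination hu3 - hw3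
  have hu1 : 1 ≤ u := hs1.trans hus
  have hα0 : 0 < α := by positivity
  have hβ0 : 0 < β := by positivity
  have e : (s - w) - (u - s) = (u - w) * (u + s + w) / (α * β) := by
    rw [eq_div_iff (by positivity)]
    have : ((s - w) - (u - s)) * (α * β) = α - β := by linear_combination α * hβ1 - β * hα1
    rw [this, hα, hβ]; ring
  have h1 : (u - w) * u ^ 2 ≤ 2 := by
    nlinarith [mul_nonneg (by linarith : 0 ≤ u - w) (by positivity : 0 ≤ u * w + w ^ 2)]
  have h2 : u ^ 2 ≤ 4 * β := by nlinarith [mul_nonneg (by linarith : 0 ≤ s) hw0, sq_nonneg w]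
  have h3 : u ^ 2 ≤ α := by nlinarith [mul_nonneg (by linarith : 0 ≤ u) (by linarith : 0 ≤ s)]
  rw [show u - s - (s - w) = -((s - w) - (u - s)) by ring, abs_neg, e,
    abs_of_nonneg (div_nonneg (mul_nonneg (by linarith) (by linarith)) (by positivity)),
    inv_pow, ← div_eq_mul_inv, div_le_div_iff₀ (by positivity) (by positivity)]
  calc (u - w) * (u + s + w) * (u ^ 2) ^ 2
      = ((u - w) * u ^ 2) * ((u + s + w) * u ^ 2) := by ring
    _ ≤ 2 * ((u + s + w) * u ^ 2) := by gcongr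
    _ ≤ 24 * (α * β) := by
        have h4 : u ^ 2 * u ^ 2 ≤ α * (4 * β) := by gcongr
        -- Using `u ≤ u ^ 2` weakens the natural rate `-5/3` to `-4/3`, which is all that
        -- summability requires.
        have h5 : u + s + w ≤ 3 * u ^ 2 := by nlinarith
        have h6 : (u + s + w) * u ^ 2 ≤ 3 * u ^ 2 * u ^ 2 := by gcongr
        nlinarith

/-- At integers only `z = 0` escapes the case `1 ≤ |z|`; negative `z` follows from the reflection
`cbrtDiff_neg_sub_one`. -/
theorem abs_cbrtDiff_sub_le (z : ℤ) :
    |cbrtDiff z - cbrtDiff (z - 1)| ≤ 24 * cbrtDecay z ^ 2 := by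
  rcases lt_trichotomy z 0 with h | rfl | h
  · have h1 : (1 : ℝ) ≤ -z := by exact_mod_cast (by omega : 1 ≤ -z)
    have := abs_cbrtDiff_sub_le_of_one_le h1
    rw [cbrtDecay_neg] at this
    have e1 := cbrtDiff_neg_sub_one z
    have e2 := cbrtDiff_neg_sub_one ((z : ℝ) - 1)
    rw [show -((z : ℝ) - 1) - 1 = -z by ring] at e2
    rw [e1, e2] at this
    convert! this using 2
    ring
  · have h0 : cbrtDiff 0 = 1 := by simp [cbrtDiff]
    have h1 : cbrtDiff (0 - 1) = -1 := by simpa [h0] using cbrtDiff_neg_sub_one 0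
    simp only [Int.cast_zero, h0, h1]
    norm_num [cbrtDecay]
  · exact abs_cbrtDiff_sub_le_of_one_le (by exact_mod_cast h)

theorem cbrtDecay_sq_eq (x : ℝ) : cbrtDecay x ^ 2 = (1 + |x|) ^ (-(4 / 3) : ℝ) := by
  have h : 0 < 1 + |x| := by positivity
  unfold cbrtDecay absCbrt
  rw [abs_of_pos h, inv_pow, ← pow_mul, ← Real.rpow_natCast, ← Real.rpow_mul h.le,
    ← Real.rpow_neg h.le]
  norm_num

theorem summable_cbrtDecay_sq : Summable fun z : ℤ => cbrtDecay z ^ 2 := by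
  have h : Summable fun n : ℕ => cbrtDecay n ^ 2 := by
    have := (summable_nat_add_iff 1).2 (Real.summable_nat_rpow (p := -(4 / 3)).2 (by norm_num))
    refine this.congr fun n => ?_
    rw [cbrtDecay_sq_eq, abs_of_nonneg (by positivity)]
    push_cast
    rw [add_comm]
  refine Summable.of_nat_of_neg (by simpa using h) ?_
  simpa [cbrtDecay_neg] using h

theorem sum_cbrtDecay_sq_le (s : Finset ℕ) (k : ℕ) :
    ∑ i ∈ s, cbrtDecay ((i : ℝ) - k) ^ 2 ≤ ∑' z : ℤ, cbrtDecay z ^ 2 := by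
  have := summable_cbrtDecay_sq.sum_le_tsum
    (s.map ⟨fun i : ℕ => (i : ℤ) - k, fun i j h => by simpa using h⟩) fun _ _ => sq_nonneg _
  rw [Finset.sum_map] at this
  refine (le_of_eq (Finset.sum_congr rfl fun i _ => ?_)).trans this
  change _ = cbrtDecay (((i : ℤ) - k : ℤ) : ℝ) ^ 2
  push_cast
  rfl

/-- In each of the three terms one index can be summed over a translate of `ℤ` at bounded cost, so
the double sum grows only linearly in `s.card`. -/
theorem sum_sum_cbrtDecay_sq_le (s : Finset ℕ) (c : ℕ) :
    ∑ i ∈ s, ∑ j ∈ s, (cbrtDecay ((i : ℝ) - c) ^ 2 + cbrtDecay ((j : ℝ) - c) ^ 2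
      + cbrtDecay ((j : ℝ) - i) ^ 2) ≤ 3 * (∑' z : ℤ, cbrtDecay z ^ 2) * s.card := by
  set Z := ∑' z : ℤ, cbrtDecay z ^ 2
  have h1 := sum_cbrtDecay_sq_le s c
  have h2 : ∑ i ∈ s, ∑ j ∈ s, cbrtDecay ((j : ℝ) - i) ^ 2 ≤ ∑ i ∈ s, Z :=
    Finset.sum_le_sum fun i _ => sum_cbrtDecay_sq_le s i
  simp only [Finset.sum_add_distrib, Finset.sum_const, nsmul_eq_mul, ← Finset.mul_sum] at h2 ⊢
  have : (0 : ℝ) ≤ s.card := by positivity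
  nlinarith

/-! ### Covariances of grid increments and midpoint averages. -/

/-- The normalised covariance of `β_r` and `ΔB_i`. -/
noncomputable def midIncrementCoeff (i r : ℕ) : ℝ :=
  (cbrtDiff (i - 1) + (cbrtDiff (((r - 1 : ℕ) : ℝ) - i) + cbrtDiff ((r : ℝ) - i)) / 2) / 2

namespace IsFractionalBrownianSixth

variable {Ω : Type*} [MeasurableSpace Ω] {P : Measure Ω} {B : ℝ≥0 → Ω → ℝ} {n : ℕ}

theorem integrable_mul (hB : IsFractionalBrownianSixth B P) (s t : ℝ≥0) :
    Integrable (fun ω => B s ω * B t ω) P :=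
  (hB.isGaussianProcess.hasGaussianLaw_eval s).memLp_two.integrable_mul
    (hB.isGaussianProcess.hasGaussianLaw_eval t).memLp_two

theorem integral_grid_mul_grid (hB : IsFractionalBrownianSixth B P) (p q : ℕ) :
    ∫ ω, B (gridTime n p) ω * B (gridTime n q) ω ∂P =
      absCbrt (1 / n) * ((absCbrt p + absCbrt q - absCbrt ((p : ℝ) - q)) / 2) := by
  have h : ∀ r : ℕ, ((gridTime n r : ℝ≥0) : ℝ) = r * (1 / n) := fun r => by
    simp [gridTime, div_eq_mul_inv]
  have h' : ∀ r : ℕ, ((gridTime n r : ℝ≥0) : ℝ) ^ (1 / 3 : ℝ) = absCbrt r * absCbrt (1 / n) :=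
    fun r => by rw [← absCbrt_mul, ← h, absCbrt, abs_of_nonneg (by positivity)]
  rw [hB.covariance, h', h', h, h, ← sub_mul]
  change _ * (_ - absCbrt _) = _
  rw [absCbrt_mul, absCbrt_sub_comm]
  ring

theorem integral_grid_mul_increment (hB : IsFractionalBrownianSixth B P) (p : ℕ)
    {i : ℕ} (hi : 1 ≤ i) :
    ∫ ω, B (gridTime n p) ω * gridIncrement B n i ω ∂P =
      absCbrt (1 / n) * ((cbrtDiff (i - 1) + cbrtDiff ((p : ℝ) - i)) / 2) := by
  simp only [gridIncrement, mul_sub]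
  rw [integral_sub (hB.integrable_mul _ _) (hB.integrable_mul _ _),
    hB.integral_grid_mul_grid, hB.integral_grid_mul_grid]
  simp only [cbrtDiff]
  push_cast [Nat.cast_sub hi]
  rw [show (p : ℝ) - (i - 1) = p - i + 1 by ring, sub_add_cancel]
  ring

theorem integrable_grid_mul_increment (hB : IsFractionalBrownianSixth B P) (p i : ℕ) :
    Integrable (fun ω => B (gridTime n p) ω * gridIncrement B n i ω) P := by
  simp only [gridIncrement, mul_sub]
  exact (hB.integrable_mul _ _).sub (hB.integrable_mul _ _)

theorem integral_mid_mul_increment (hB : IsFractionalBrownianSixth B P) (r : ℕ)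
    {i : ℕ} (hi : 1 ≤ i) :
    ∫ ω, midAverage B n r ω * gridIncrement B n i ω ∂P =
      absCbrt (1 / n) * midIncrementCoeff i r := by
  have e : ∫ ω, midAverage B n r ω * gridIncrement B n i ω ∂P
      = ∫ ω, (1 / 2) * (B (gridTime n (r - 1)) ω * gridIncrement B n i ω
        + B (gridTime n r) ω * gridIncrement B n i ω) ∂P := by
    congr 1; ext ω; simp only [midAverage]; ring
  rw [e, integral_const_mul, integral_add (hB.integrable_grid_mul_increment _ _)
    (hB.integrable_grid_mul_increment _ _), hB.integral_grid_mul_increment _ hi,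
    hB.integral_grid_mul_increment _ hi, midIncrementCoeff]
  ring

theorem integral_increment_mul_increment (hB : IsFractionalBrownianSixth B P)
    {i j : ℕ} (hi : 1 ≤ i) (hj : 1 ≤ j) :
    ∫ ω, gridIncrement B n j ω * gridIncrement B n i ω ∂P =
      absCbrt (1 / n) * ((cbrtDiff ((j : ℝ) - i) - cbrtDiff ((j : ℝ) - i - 1)) / 2) := by
  have e : ∫ ω, gridIncrement B n j ω * gridIncrement B n i ω ∂P
      = ∫ ω, (B (gridTime n j) ω * gridIncrement B n i ω
        - B (gridTime n (j - 1)) ω * gridIncrement B n i ω) ∂P := by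
    congr 1; ext ω; rw [← sub_mul]; rfl
  rw [e, integral_sub (hB.integrable_grid_mul_increment _ _)
    (hB.integrable_grid_mul_increment _ _), hB.integral_grid_mul_increment _ hi,
    hB.integral_grid_mul_increment _ hi]
  push_cast [Nat.cast_sub hj]
  rw [show (j : ℝ) - 1 - i = j - i - 1 by ring]
  ring

theorem integral_increment_sq (hB : IsFractionalBrownianSixth B P)
    {i : ℕ} (hi : 1 ≤ i) :
    ∫ ω, gridIncrement B n i ω * gridIncrement B n i ω ∂P = absCbrt (1 / n) := by
  have h := cbrtDiff_neg_sub_one 0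
  rw [neg_zero] at h
  rw [hB.integral_increment_mul_increment hi hi, sub_self, h]
  simp [cbrtDiff]

theorem integral_grid_sub_sq (hB : IsFractionalBrownianSixth B P) (p q : ℕ) :
    ∫ ω, (B (gridTime n p) ω - B (gridTime n q) ω) ^ 2 ∂P =
      absCbrt (1 / n) * absCbrt ((p : ℝ) - q) := by
  have e : ∫ ω, (B (gridTime n p) ω - B (gridTime n q) ω) ^ 2 ∂P
      = ∫ ω, (B (gridTime n p) ω * B (gridTime n p) ω
        - 2 * (B (gridTime n p) ω * B (gridTime n q) ω)
        + B (gridTime n q) ω * B (gridTime n q) ω) ∂P := by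
    congr 1; ext ω; ring
  have i1 := hB.integrable_mul (gridTime n p) (gridTime n p)
  have i2 := (hB.integrable_mul (gridTime n p) (gridTime n q)).const_mul 2
  have i3 : Integrable (fun ω => B (gridTime n p) ω * B (gridTime n p) ω
      - 2 * (B (gridTime n p) ω * B (gridTime n q) ω)) P := i1.sub i2
  rw [e, integral_add i3 (hB.integrable_mul _ _), integral_sub i1 i2, integral_const_mul,
    hB.integral_grid_mul_grid, hB.integral_grid_mul_grid, hB.integral_grid_mul_grid]
  simp only [sub_self, absCbrt_zero]
  ring

theorem integrable_grid_sub_sq (hB : IsFractionalBrownianSixth B P) (p q : ℕ) :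
    Integrable (fun ω => (B (gridTime n p) ω - B (gridTime n q) ω) ^ 2) P :=
  ((hB.isGaussianProcess.hasGaussianLaw_eval _).memLp_two.sub
    (hB.isGaussianProcess.hasGaussianLaw_eval _).memLp_two).integrable_sq

theorem integral_mid_sub_sq_le (hB : IsFractionalBrownianSixth B P) {c i d : ℕ}
    (hci : c ≤ i) (hid : i ≤ d) :
    ∫ ω, (midAverage B n i ω - midAverage B n c ω) ^ 2 ∂P ≤
      absCbrt (1 / n) * absCbrt ((d : ℝ) - c) := by
  have hle : ∀ p q : ℕ, q ≤ p → p + c ≤ d + q →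
      absCbrt ((p : ℝ) - q) ≤ absCbrt ((d : ℝ) - c) := by
    intro p q h1 h2
    have h1' : (q : ℝ) ≤ p := by exact_mod_cast h1
    have h2' : (p : ℝ) + c ≤ d + q := by exact_mod_cast h2
    refine absCbrt_le ?_
    rw [abs_of_nonneg (by linarith), abs_of_nonneg (by linarith)]
    linarith
  have i1 := hB.integrable_grid_sub_sq (n := n) (i - 1) (c - 1)
  have i2 := hB.integrable_grid_sub_sq (n := n) i c
  have h1 := hle (i - 1) (c - 1) (by omega) (by omega)
  have h2 := hle i c (by omega) (by omega)
  have h0 := absCbrt_nonneg (1 / n)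
  calc ∫ ω, (midAverage B n i ω - midAverage B n c ω) ^ 2 ∂P
      ≤ ∫ ω, (1 / 2) * ((B (gridTime n (i - 1)) ω - B (gridTime n (c - 1)) ω) ^ 2
        + (B (gridTime n i) ω - B (gridTime n c) ω) ^ 2) ∂P := by
        refine integral_mono_of_nonneg (Filter.Eventually.of_forall fun _ => sq_nonneg _)
          ((i1.add i2).const_mul _) (Filter.Eventually.of_forall fun ω => ?_)
        simp only [midAverage]
        nlinarith [sq_nonneg ((B (gridTime n (i - 1)) ω - B (gridTime n (c - 1)) ω)
          - (B (gridTime n i) ω - B (gridTime n c) ω))]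
    _ = (1 / 2) * (absCbrt (1 / n) * absCbrt (((i - 1 : ℕ) : ℝ) - (c - 1 : ℕ))
        + absCbrt (1 / n) * absCbrt ((i : ℝ) - c)) := by
        rw [integral_const_mul, integral_add i1 i2, hB.integral_grid_sub_sq,
          hB.integral_grid_sub_sq]
    _ ≤ (1 / 2) * (absCbrt (1 / n) * absCbrt ((d : ℝ) - c)
        + absCbrt (1 / n) * absCbrt ((d : ℝ) - c)) := by gcongr
    _ = _ := by ring

theorem integral_increment (hB : IsFractionalBrownianSixth B P) (i : ℕ) :
    ∫ ω, gridIncrement B n i ω ∂P = 0 := by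
  have h := fun t => (hB.isGaussianProcess.hasGaussianLaw_eval t).integrable
  simp only [gridIncrement]
  rw [integral_sub (h _) (h _), hB.centered, hB.centered, sub_zero]

/-- Midpoint averages and increments form a Gaussian process. -/
theorem isGaussianProcess_mid_increment (hB : IsFractionalBrownianSixth B P) :
    IsGaussianProcess (Sum.elim (midAverage B n) (gridIncrement B n)) P := by
  refine hB.isGaussianProcess.of_isGaussianProcess fun s => ?_
  rcases s with j | j
  · refine ⟨{gridTime n (j - 1), gridTime n j},
      (1 / 2 : ℝ) • (ContinuousLinearMap.proj ⟨gridTime n (j - 1), by simp⟩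
        + ContinuousLinearMap.proj ⟨gridTime n j, by simp⟩), fun ω => ?_⟩
    simp [midAverage]
    ring
  · refine ⟨{gridTime n (j - 1), gridTime n j},
      ContinuousLinearMap.proj ⟨gridTime n j, by simp⟩
        - ContinuousLinearMap.proj ⟨gridTime n (j - 1), by simp⟩, fun ω => ?_⟩
    simp [gridIncrement]

end IsFractionalBrownianSixth

section CoefficientBounds

variable {c i j : ℕ}

theorem abs_cbrtDiff_sub_one_le (hi : c < i) :
    |cbrtDiff ((i : ℝ) - 1)| ≤ 6 * cbrtDecay ((i : ℝ) - c) := by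
  have h1 := abs_cbrtDiff_le ((i : ℝ) - 1)
  have hi' : (c : ℝ) + 1 ≤ i := by exact_mod_cast hi
  have hc : (0 : ℝ) ≤ c := by positivity
  have h2 : cbrtDecay ((i : ℝ) - 1) ≤ cbrtDecay ((i : ℝ) - c - 1) := cbrtDecay_anti (by
    rw [abs_of_nonneg (by linarith), abs_of_nonneg (by linarith)]; linarith)
  have h3 := cbrtDecay_sub_one_le ((i : ℝ) - c)
  linarith

theorem abs_midIncrementCoeff_self_le (hi : c < i) :
    |midIncrementCoeff i i| ≤ 3 * cbrtDecay ((i : ℝ) - c) := by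
  have h1 := abs_cbrtDiff_sub_one_le hi
  have h := cbrtDiff_neg_sub_one 0
  have e : midIncrementCoeff i i = cbrtDiff ((i : ℝ) - 1) / 2 := by
    rw [midIncrementCoeff, Nat.cast_sub (by omega : 1 ≤ i), sub_self,
      show (i : ℝ) - (1 : ℕ) - i = -0 - 1 by push_cast; ring, h]
    ring
  rw [e, abs_div, abs_two]
  linarith

theorem abs_midIncrementCoeff_le (hi : c < i) (hj : c < j) :
    |midIncrementCoeff i j| ≤ 3 * cbrtDecay ((i : ℝ) - c) + 3 * cbrtDecay ((j : ℝ) - i) := by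
  have h1 := abs_cbrtDiff_sub_one_le hi
  have h2 := abs_cbrtDiff_le ((j : ℝ) - i)
  have h3 := abs_cbrtDiff_le ((j : ℝ) - i - 1)
  have h4 := cbrtDecay_sub_one_le ((j : ℝ) - i)
  have e : ((j - 1 : ℕ) : ℝ) - i = j - i - 1 := by
    rw [Nat.cast_sub (by omega : 1 ≤ j)]; push_cast; ring
  rw [midIncrementCoeff, e]
  have p1 := cbrtDecay_pos ((j : ℝ) - i)
  rw [abs_le] at h1 h2 h3 ⊢
  constructor <;> linarith [h1.1, h1.2, h2.1, h2.2, h3.1, h3.2]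

theorem abs_midIncrementCoeff_base_le (hi : c < i) :
    |midIncrementCoeff i c| ≤ 5 * cbrtDecay ((i : ℝ) - c) := by
  have h1 := abs_cbrtDiff_sub_one_le hi
  have h2 := abs_cbrtDiff_le ((c : ℝ) - i)
  have h3 := abs_cbrtDiff_le (((c - 1 : ℕ) : ℝ) - i)
  have hi' : (c : ℝ) + 1 ≤ i := by exact_mod_cast hi
  have hc : ((c - 1 : ℕ) : ℝ) ≤ c := by exact_mod_cast Nat.sub_le c 1
  rw [cbrtDecay_sub_comm] at h2
  have h4 : cbrtDecay (((c - 1 : ℕ) : ℝ) - i) ≤ cbrtDecay ((i : ℝ) - c) := cbrtDecay_anti (by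
    rw [abs_of_nonneg (by linarith), abs_of_nonpos (by linarith)]; linarith)
  have p1 := cbrtDecay_pos ((i : ℝ) - c)
  rw [midIncrementCoeff]
  rw [abs_le] at h1 h2 h3 ⊢
  constructor <;> linarith [h1.1, h1.2, h2.1, h2.2, h3.1, h3.2]

theorem abs_increment_corr_le (i j : ℕ) :
    |(cbrtDiff ((j : ℝ) - i) - cbrtDiff ((j : ℝ) - i - 1)) / 2| ≤
      12 * cbrtDecay ((j : ℝ) - i) ^ 2 := by
  have := abs_cbrtDiff_sub_le ((j : ℤ) - i)
  push_cast at this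
  rw [abs_div, abs_two]
  linarith

end CoefficientBounds

theorem ContDiff.exists_isBoundedJet {g : ℝ → ℝ} (hg : ContDiff ℝ 3 g)
    (hgc : HasCompactSupport g) : ∃ M, IsBoundedJet (fun k => iteratedDeriv k g) M := by
  have hc : ∀ k ≤ 3, Continuous (iteratedDeriv k g) := fun k hk =>
    hg.continuous_iteratedDeriv k (by exact_mod_cast hk)
  have hs : ∀ k, HasCompactSupport (iteratedDeriv k g) := by
    intro k
    induction k with
    | zero => simpa using hgc
    | succ k ih => rw [iteratedDeriv_succ]; exact ih.deriv
  have hb : ∀ k, ∃ M, k ≤ 3 → ∀ x, |iteratedDeriv k g x| ≤ M := fun k => by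
    by_cases hk : k ≤ 3
    · obtain ⟨M, hM⟩ := (hs k).exists_bound_of_continuous (hc k hk)
      exact ⟨M, fun _ => hM⟩
    · exact ⟨0, fun h => absurd h hk⟩
  choose M hM using hb
  have h0 : ∀ k ≤ 3, 0 ≤ M k := fun k hk => (abs_nonneg _).trans (hM k hk 0)
  refine ⟨∑ k ∈ Finset.range 4, M k, ⟨fun k hk x => ?_, hc, fun k hk x => (hM k hk x).trans ?_⟩⟩
  · rw [iteratedDeriv_succ]
    exact (hg.differentiable_iteratedDeriv k (by exact_mod_cast hk) x).hasDerivAt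
  · exact Finset.single_le_sum (f := M) (fun i hi => h0 i (by simp at hi; omega))
      (by simp; omega)

theorem integral_sum_sq_le {Ω ι : Type*} [MeasurableSpace Ω] {P : Measure Ω} {s : Finset ι}
    {U : ι → Ω → ℝ} {b : ι → ι → ℝ}
    (hi : ∀ i ∈ s, ∀ j ∈ s, Integrable (fun ω => U i ω * U j ω) P)
    (hb : ∀ i ∈ s, ∀ j ∈ s, |∫ ω, U i ω * U j ω ∂P| ≤ b i j) :
    Integrable (fun ω => (∑ i ∈ s, U i ω) ^ 2) P ∧
      ∫ ω, (∑ i ∈ s, U i ω) ^ 2 ∂P ≤ ∑ i ∈ s, ∑ j ∈ s, b i j := by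
  simp only [sq, Finset.sum_mul_sum]
  refine ⟨integrable_finsetSum _ fun i h => integrable_finsetSum _ fun j h' => hi i h j h', ?_⟩
  rw [integral_finsetSum _ fun i h => integrable_finsetSum _ fun j h' => hi i h j h']
  refine Finset.sum_le_sum fun i h => ?_
  rw [integral_finsetSum _ fun j h' => hi i h j h']
  exact Finset.sum_le_sum fun j h' => (le_abs_self _).trans (hb i h j h')

/-- The weight controlling the correlation of the summands with indices `i` and `j`. -/
noncomputable def pairWeight (c i j : ℕ) : ℝ :=
  cbrtDecay ((i : ℝ) - c) ^ 2 + cbrtDecay ((j : ℝ) - c) ^ 2 + cbrtDecay ((j : ℝ) - i) ^ 2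

theorem cube_weight_le {p r : ℝ} (q : ℝ) (hp : 0 < p) (hr : 0 < r) (hp1 : p ≤ 1) (hr1 : r ≤ 1) :
    (12 * (p + r)) ^ 3 ≤ 6912 * (p ^ 2 + q ^ 2 + r ^ 2) := by
  have h2 : (p + r) ^ 2 ≤ 2 * (p ^ 2 + q ^ 2 + r ^ 2) := by
    linarith [sq_nonneg (p - r), sq_nonneg q]
  have h3 : (p + r) ^ 3 ≤ 2 * (p + r) ^ 2 := by
    rw [pow_succ' (p + r) 2]
    gcongr
    linarith
  rw [mul_pow]
  linarith

theorem mul_weight_add_le (p q : ℝ) {r x : ℝ} (hx : x ≤ 12 * r ^ 2) :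
    16 * (12 * (p + r) * (12 * (q + r))) + x ≤ 4000000 * (p ^ 2 + q ^ 2 + r ^ 2) := by
  linarith [sq_nonneg (p - r), sq_nonneg (q - r), sq_nonneg (p - q), sq_nonneg p, sq_nonneg q,
    sq_nonneg r]

section PairEstimates

variable {Ω : Type*} [MeasurableSpace Ω] {P : Measure Ω} {B : ℝ≥0 → Ω → ℝ} {n c d : ℕ}
  {g : ℕ → ℝ → ℝ} {M : ℝ}

theorem IsFractionalBrownianSixth.pair_estimates (hB : IsFractionalBrownianSixth B P)
    (hg : IsBoundedJet g M) (hn : 0 < n) {i j : ℕ} (hci : c < i) (hid : i ≤ d) (hcj : c < j)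
    (hjd : j ≤ d) {v e : ℝ} (hv : v = absCbrt (1 / n)) (he : e = v * absCbrt ((d : ℝ) - c)) :
    (∀ f h : ℝ → ℝ, HasPolyGrowth f → HasPolyGrowth h → Integrable (fun ω =>
      (g 0 (midAverage B n i ω) - g 0 (midAverage B n c ω)) * f (gridIncrement B n i ω) *
      ((g 0 (midAverage B n j ω) - g 0 (midAverage B n c ω)) * h (gridIncrement B n j ω))) P) ∧
    |∫ ω, (g 0 (midAverage B n i ω) - g 0 (midAverage B n c ω)) *
        (gridIncrement B n i ω ^ 3 - 3 * v * gridIncrement B n i ω) *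
      ((g 0 (midAverage B n j ω) - g 0 (midAverage B n c ω)) *
        (gridIncrement B n j ω ^ 3 - 3 * v * gridIncrement B n j ω)) ∂P| ≤
      4000000 * M ^ 2 * (v ^ 3 * e) * pairWeight c i j ∧
    |∫ ω, (g 0 (midAverage B n i ω) - g 0 (midAverage B n c ω)) * (v * gridIncrement B n i ω) *
      ((g 0 (midAverage B n j ω) - g 0 (midAverage B n c ω)) * (v * gridIncrement B n j ω)) ∂P| ≤
      4000000 * M ^ 2 * (v ^ 3 * e) * pairWeight c i j := by
  let I : Finset (ℕ ⊕ ℕ) := {Sum.inl i, Sum.inl j, Sum.inl c, Sum.inr i, Sum.inr j}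
  let W : Ω → I → ℝ := fun ω r => Sum.elim (midAverage B n) (gridIncrement B n) r.1 ω
  have hW : HasGaussianLaw W P := (hB.isGaussianProcess_mid_increment (n := n)).hasGaussianLaw I
  let bi : I := ⟨Sum.inl i, by simp [I]⟩
  let bj : I := ⟨Sum.inl j, by simp [I]⟩
  let bc : I := ⟨Sum.inl c, by simp [I]⟩
  let xi : I := ⟨Sum.inr i, by simp [I]⟩
  let xj : I := ⟨Sum.inr j, by simp [I]⟩
  have hM := hg.nonneg
  have hn0 : (0 : ℝ) < n := by exact_mod_cast hn
  have hv3 : v ^ 3 = 1 / n := by rw [hv, absCbrt_pow_three, abs_of_pos (by positivity)]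
  have hv0 : 0 < v := by
    have h : 0 ≤ v := hv ▸ absCbrt_nonneg _
    have h3 : v ^ 3 ≠ 0 := by rw [hv3]; positivity
    exact lt_of_le_of_ne h fun h' => h3 (by rw [← h']; norm_num)
  have hv1 : v ≤ 1 := by
    have : absCbrt (1 / n) ≤ absCbrt 1 := absCbrt_le (by
      rw [abs_of_pos (by positivity), abs_one, div_le_one hn0]
      exact_mod_cast hn)
    simpa [hv] using this
  have hcd : (c : ℝ) + 1 ≤ d := by exact_mod_cast (by omega : c + 1 ≤ d)
  have hve : v ≤ e := by
    rw [he]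
    refine le_mul_of_one_le_right hv0.le (one_le_absCbrt ?_)
    rw [abs_of_nonneg (by linarith)]
    linarith
  have he0 : 0 ≤ e := hv0.le.trans hve
  have hxi0 : ∫ ω, W ω xi ∂P = 0 := hB.integral_increment i
  have hxj0 : ∫ ω, W ω xj ∂P = 0 := hB.integral_increment j
  have hxi : ∫ ω, W ω xi * W ω xi ∂P = v := hv ▸ hB.integral_increment_sq (by omega)
  have hxj : ∫ ω, W ω xj * W ω xj ∂P = v := hv ▸ hB.integral_increment_sq (by omega)
  have hic : ∫ ω, (W ω bi - W ω bc) ^ 2 ∂P ≤ e := by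
    rw [he, hv]; exact hB.integral_mid_sub_sq_le hci.le hid
  have hjc : ∫ ω, (W ω bj - W ω bc) ^ 2 ∂P ≤ e := by
    rw [he, hv]; exact hB.integral_mid_sub_sq_le hcj.le hjd
  let a : I → ℝ := fun r => (∫ ω, W ω r * W ω xi ∂P) / v
  let b : I → ℝ := fun r => (∫ ω, W ω r * W ω xj ∂P) / v
  have ha : ∀ r, ∫ ω, W ω r * W ω xi ∂P = v * a r := fun r => by simp only [a]; field_simp
  have hb : ∀ r, ∫ ω, W ω r * W ω xj ∂P = v * b r := fun r => by simp only [b]; field_simp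
  have coeff : ∀ {x y : ℝ}, x = absCbrt (1 / n) * y → x / v = y := fun {x y} h => by
    rw [h, ← hv]; field_simp
  have ai : a bi = midIncrementCoeff i i := coeff (hB.integral_mid_mul_increment i (by omega))
  have aj : a bj = midIncrementCoeff i j := coeff (hB.integral_mid_mul_increment j (by omega))
  have ac : a bc = midIncrementCoeff i c := coeff (hB.integral_mid_mul_increment c (by omega))
  have bi' : b bi = midIncrementCoeff j i := coeff (hB.integral_mid_mul_increment i (by omega))
  have bj' : b bj = midIncrementCoeff j j := coeff (hB.integral_mid_mul_increment j (by omega))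
  have bc' : b bc = midIncrementCoeff j c := coeff (hB.integral_mid_mul_increment c (by omega))
  have al : a xj = (cbrtDiff ((j : ℝ) - i) - cbrtDiff ((j : ℝ) - i - 1)) / 2 :=
    coeff (hB.integral_increment_mul_increment (by omega) (by omega))
  have hal : |a xj| ≤ 12 * cbrtDecay ((j : ℝ) - i) ^ 2 := al ▸ abs_increment_corr_le i j
  have hai : |a bi| ≤ 3 * cbrtDecay ((i : ℝ) - c) := ai ▸ abs_midIncrementCoeff_self_le hci
  have haj : |a bj| ≤ 3 * cbrtDecay ((i : ℝ) - c) + 3 * cbrtDecay ((j : ℝ) - i) :=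
    aj ▸ abs_midIncrementCoeff_le hci hcj
  have hac : |a bc| ≤ 5 * cbrtDecay ((i : ℝ) - c) := ac ▸ abs_midIncrementCoeff_base_le hci
  have hbi : |b bi| ≤ 3 * cbrtDecay ((j : ℝ) - c) + 3 * cbrtDecay ((j : ℝ) - i) := by
    rw [bi', cbrtDecay_sub_comm (j : ℝ) i]; exact abs_midIncrementCoeff_le hcj hci
  have hbj : |b bj| ≤ 3 * cbrtDecay ((j : ℝ) - c) := bj' ▸ abs_midIncrementCoeff_self_le hcj
  have hbc : |b bc| ≤ 5 * cbrtDecay ((j : ℝ) - c) := bc' ▸ abs_midIncrementCoeff_base_le hcj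
  have hp := cbrtDecay_pos ((i : ℝ) - c)
  have hq := cbrtDecay_pos ((j : ℝ) - c)
  have hr := cbrtDecay_pos ((j : ℝ) - i)
  have hp1 := cbrtDecay_le_one ((i : ℝ) - c)
  have hr1 := cbrtDecay_le_one ((j : ℝ) - i)
  unfold pairWeight
  set p := cbrtDecay ((i : ℝ) - c)
  set q := cbrtDecay ((j : ℝ) - c)
  set r := cbrtDecay ((j : ℝ) - i)
  have hal' : |a xj| ≤ 12 * (p + r) := hal.trans (by nlinarith)
  refine ⟨fun f h hf hh => ?_, ?_, ?_⟩
  · have hG : ∀ k l : I, HasPolyGrowth (fun y : I → ℝ => g 0 (y k) - g 0 (y l)) := fun k l => by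
      have h := ((hg.isPolyChain_diffJet (a := a) k l) 0 (by norm_num)).left
      unfold diffJet at h
      simpa only [pow_zero, one_mul] using h
    exact (((hG bi bc).mul (hf.comp_coord xi)).mul ((hG bj bc).mul (hh.comp_coord xj))).integrable_comp hW
  · refine (hg.abs_integral_hermite_pair_le (S := 12 * (p + r)) (i := bi) (j := bj) (c := bc)
      (k := xi) (l := xj) hW hv0 hv1 hve hxi0 hxi hxj0 hxj ha hic hjc
      (by linarith) (by linarith) (by linarith) hal').trans ?_
    have h1 := cube_weight_le q hp hr hp1 hr1
    calc 526 * M ^ 2 * (v ^ 3 * e * (12 * (p + r)) ^ 3)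
        ≤ 526 * M ^ 2 * (v ^ 3 * e * (6912 * (p ^ 2 + q ^ 2 + r ^ 2))) := by gcongr
      _ = 3635712 * (M ^ 2 * (v ^ 3 * e) * (p ^ 2 + q ^ 2 + r ^ 2)) := by ring
      _ ≤ 4000000 * (M ^ 2 * (v ^ 3 * e) * (p ^ 2 + q ^ 2 + r ^ 2)) := by gcongr; norm_num
      _ = _ := by ring
  · refine (hg.abs_integral_linear_pair_le (S := 12 * (p + r)) (S' := 12 * (q + r)) (i := bi)
      (j := bj) (c := bc) (k := xi) (l := xj) hW hv0 hve hxi0 hxi hxj0 hxj ha hb hic hjc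
      (by linarith) (by linarith) (by linarith) (by linarith) (by linarith) (by linarith)).trans ?_
    have h1 := mul_weight_add_le p q hal
    calc M ^ 2 * (v ^ 3 * e * (16 * (12 * (p + r) * (12 * (q + r))) + |a xj|))
        ≤ M ^ 2 * (v ^ 3 * e * (4000000 * (p ^ 2 + q ^ 2 + r ^ 2))) := by gcongr
      _ = _ := by ring

end PairEstimates

theorem IsFractionalBrownianSixth.integral_sum_diff_mul_cube_sq_le {Ω : Type*} [MeasurableSpace Ω]
    {P : Measure Ω} {B : ℝ≥0 → Ω → ℝ} {n c d : ℕ} {g : ℕ → ℝ → ℝ} {M : ℝ}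
    (hB : IsFractionalBrownianSixth B P) (hg : IsBoundedJet g M) (hn : 0 < n) (hcd : c < d) :
    Integrable (fun ω => (∑ j ∈ Finset.Icc (c + 1) d,
      (g 0 (midAverage B n j ω) - g 0 (midAverage B n c ω)) * gridIncrement B n j ω ^ 3) ^ 2) P ∧
    ∫ ω, (∑ j ∈ Finset.Icc (c + 1) d,
      (g 0 (midAverage B n j ω) - g 0 (midAverage B n c ω)) * gridIncrement B n j ω ^ 3) ^ 2 ∂P ≤
      240000000 * M ^ 2 * (∑' z : ℤ, cbrtDecay z ^ 2) *
        (absCbrt (1 / n) * absCbrt ((d : ℝ) - c)) ^ 4 := by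
  obtain ⟨v, hv⟩ : ∃ v, v = absCbrt (1 / n) := ⟨_, rfl⟩
  obtain ⟨e, he⟩ : ∃ e, e = v * absCbrt ((d : ℝ) - c) := ⟨_, rfl⟩
  have hest := fun i (hi : i ∈ Finset.Icc (c + 1) d) j (hj : j ∈ Finset.Icc (c + 1) d) =>
    hB.pair_estimates hg hn (Finset.mem_Icc.1 hi).1 (Finset.mem_Icc.1 hi).2
      (Finset.mem_Icc.1 hj).1 (Finset.mem_Icc.1 hj).2 hv he
  have hid := HasPolyGrowth.id_real
  have hH : HasPolyGrowth (fun x : ℝ => x ^ 3 - 3 * v * x) :=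
    (hid.pow 3).sub ((HasPolyGrowth.const (3 * v)).mul hid)
  have hL : HasPolyGrowth (fun x : ℝ => v * x) := (HasPolyGrowth.const v).mul hid
  obtain ⟨iH, bH⟩ := integral_sum_sq_le (fun i hi j hj => (hest i hi j hj).1 _ _ hH hH)
    (fun i hi j hj => (hest i hi j hj).2.1)
  obtain ⟨iL, bL⟩ := integral_sum_sq_le (fun i hi j hj => (hest i hi j hj).1 _ _ hL hL)
    (fun i hi j hj => (hest i hi j hj).2.2)
  obtain ⟨iC, -⟩ := integral_sum_sq_le (fun i hi j hj => (hest i hi j hj).1 _ _ (hid.pow 3)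
    (hid.pow 3)) (fun i _ j _ => le_rfl)
  refine ⟨iC, ?_⟩
  have hM := hg.nonneg
  have hcd' : (c : ℝ) < d := by exact_mod_cast hcd
  have hsum : ∑ i ∈ Finset.Icc (c + 1) d, ∑ j ∈ Finset.Icc (c + 1) d,
      4000000 * M ^ 2 * (v ^ 3 * e) * pairWeight c i j ≤
      12000000 * M ^ 2 * (∑' z : ℤ, cbrtDecay z ^ 2) * e ^ 4 := by
    have h1 := sum_sum_cbrtDecay_sq_le (Finset.Icc (c + 1) d) c
    have h2 : ((Finset.Icc (c + 1) d).card : ℝ) = absCbrt ((d : ℝ) - c) ^ 3 := by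
      rw [absCbrt_pow_three, abs_of_pos (by linarith), Nat.card_Icc, Nat.add_sub_add_right,
        Nat.cast_sub hcd.le]
    rw [h2] at h1
    have he0 : 0 ≤ v ^ 3 * e := by
      have := absCbrt_nonneg (1 / n)
      have := absCbrt_nonneg ((d : ℝ) - c)
      rw [he, hv]; positivity
    simp only [← Finset.mul_sum]
    calc _ ≤ 4000000 * M ^ 2 * (v ^ 3 * e) *
          (3 * (∑' z : ℤ, cbrtDecay z ^ 2) * absCbrt ((d : ℝ) - c) ^ 3) := by
          gcongr
          exact h1
      _ = _ := by rw [he]; ring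
  calc _ ≤ ∫ ω, (2 * (∑ j ∈ Finset.Icc (c + 1) d,
          (g 0 (midAverage B n j ω) - g 0 (midAverage B n c ω)) *
            (gridIncrement B n j ω ^ 3 - 3 * v * gridIncrement B n j ω)) ^ 2
        + 18 * (∑ j ∈ Finset.Icc (c + 1) d,
          (g 0 (midAverage B n j ω) - g 0 (midAverage B n c ω)) *
            (v * gridIncrement B n j ω)) ^ 2) ∂P := by
        refine integral_mono iC ((iH.const_mul 2).add (iL.const_mul 18)) fun ω => ?_
        have e : ∀ j, (g 0 (midAverage B n j ω) - g 0 (midAverage B n c ω)) *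
            gridIncrement B n j ω ^ 3 = (g 0 (midAverage B n j ω) - g 0 (midAverage B n c ω)) *
            (gridIncrement B n j ω ^ 3 - 3 * v * gridIncrement B n j ω)
            + 3 * ((g 0 (midAverage B n j ω) - g 0 (midAverage B n c ω)) *
              (v * gridIncrement B n j ω)) := fun j => by ring
        simp only [e, Finset.sum_add_distrib, ← Finset.mul_sum]
        set x := ∑ j ∈ Finset.Icc (c + 1) d, (g 0 (midAverage B n j ω) -
          g 0 (midAverage B n c ω)) * (gridIncrement B n j ω ^ 3 - 3 * v * gridIncrement B n j ω)
        set y := ∑ j ∈ Finset.Icc (c + 1) d, (g 0 (midAverage B n j ω) -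
          g 0 (midAverage B n c ω)) * (v * gridIncrement B n j ω)
        nlinarith [sq_nonneg (x - 3 * y)]
    _ ≤ 2 * (12000000 * M ^ 2 * (∑' z : ℤ, cbrtDecay z ^ 2) * e ^ 4)
        + 18 * (12000000 * M ^ 2 * (∑' z : ℤ, cbrtDecay z ^ 2) * e ^ 4) := by
        rw [integral_add (iH.const_mul 2) (iL.const_mul 18), integral_const_mul,
          integral_const_mul]
        exact add_le_add (mul_le_mul_of_nonneg_left (bH.trans hsum) (by norm_num))
          (mul_le_mul_of_nonneg_left (bL.trans hsum) (by norm_num))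
    _ = _ := by rw [he, hv]; ring

theorem theorem4p4 (g : ℝ → ℝ) (hg : ContDiff ℝ 3 g) (hgc : HasCompactSupport g)
    (T : ℝ) (hT : 0 < T) :
    ∃ C : ℝ, 0 < C ∧
      ∀ (Ω : Type*) [MeasurableSpace Ω] (P : Measure Ω) [IsProbabilityMeasure P]
        (B : ℝ≥0 → Ω → ℝ), IsFractionalBrownianSixth B P →
      ∀ n c d : ℕ, 0 < n → gridTime n c < gridTime n d → (gridTime n d : ℝ) ≤ T →
        Integrable (fun ω => |∑ j ∈ Finset.Icc (c + 1) d,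
          (g (midAverage B n j ω) - g (midAverage B n c ω)) * gridIncrement B n j ω ^ 3| ^ 2) P ∧
        ∫ ω, |∑ j ∈ Finset.Icc (c + 1) d,
          (g (midAverage B n j ω) - g (midAverage B n c ω)) * gridIncrement B n j ω ^ 3| ^ 2 ∂P
          ≤ C * |(gridTime n d : ℝ) - (gridTime n c : ℝ)| ^ (4 / 3 : ℝ) := by
  obtain ⟨M, hM⟩ := hg.exists_isBoundedJet hgc
  have hZ : 0 ≤ ∑' z : ℤ, cbrtDecay z ^ 2 := tsum_nonneg fun _ => sq_nonneg _
  refine ⟨240000000 * M ^ 2 * (∑' z : ℤ, cbrtDecay z ^ 2) + 1, by positivity, ?_⟩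
  intro Ω _ P _ B hB n c d hn hlt _
  have hcd : c < d := by
    by_contra! h
    refine absurd hlt (not_lt.2 ?_)
    unfold gridTime
    gcongr
  obtain ⟨h1, h2⟩ := hB.integral_sum_diff_mul_cube_sq_le hM hn hcd
  simp only [iteratedDeriv_zero] at h1 h2
  simp only [sq_abs]
  refine ⟨h1, h2.trans ?_⟩
  have e : (absCbrt (1 / n) * absCbrt ((d : ℝ) - c)) ^ 4
      = |(gridTime n d : ℝ) - (gridTime n c : ℝ)| ^ (4 / 3 : ℝ) := by
    rw [← absCbrt_mul, absCbrt, ← Real.rpow_natCast, ← Real.rpow_mul (abs_nonneg _)]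
    congr 1
    · simp only [gridTime, NNReal.coe_div, NNReal.coe_natCast]
      congr 1
      ring
    · norm_num
  rw [e]
  gcongr
  linarith
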